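/- Let $M$ be the figure-eight knot complement, with $\pi_1(M)=\langle x,y \mid ax=ya\rangle$, $a=xy^{-1}x^{-1}y$; put $b=xy^{-1}$, and let $F_2=\langle a,b\rangle\trianglelefteq\pi_1(M)$ be the fundamental group of the once-punctured torus fiber $F$ of the fibration $M\to S^1$, whose monodromy is conjugation by the meridian $x$. Let the hyperbolic Dehn filling space $\mathcal D$ of $M$ be the set of pairs $(z_1,z_2)\in\mathbb C^2$ of shapes with $\operatorname{Im} z_1,\operatorname{Im} z_2>0$ that satisfy the edge equations of the ideal triangulation of $M$ by two tetrahedra, $$2\operatorname{Log}z_1+\operatorname{Log}\tfrac1{1-z_1}+\operatorname{Log}z_2+2\operatorname{Log}\bigl(1-\tfrac1{z_2}\bigr)=2\pi i,$$ $$\operatorname{Log}\tfrac1{1-z_1}+2\operatorname{Log}\bigl(1-\tfrac1{z_1}\bigr)+\operatorname{Log}z_2+2\operatorname{Log}\tfrac1{1-z_2}=2\pi i,$$ with coordinate $u=\operatorname{Log}(z_1(1-z_2))\in\mathbb C$, the complex length of the meridian. A point of $\mathcal D$ with coordinate $u$ determines the holonomy $\rho_u:\pi_1(M)\to \mathrm{PSL}(2,\mathbb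 C)\cong \mathrm{PSO}(3,1)\subset \mathrm{PGL}(4,\mathbb R)$ which sends $x$ and $y$ to the Möbius maps $w\mapsto (w-1)/m$ and $w\mapsto mw/(1-z_2w)$, where $m=z_1(1-z_2)$. Let $\mathfrak v$ be the orthogonal complement of $\mathfrak{so}(3,1)$ in $\mathfrak{sl}(4,\mathbb R)$ for the Killing form, and let $\mathfrak v_u$ be $\mathfrak v$ with the action $\gamma\cdot v=\rho_u(\gamma)v\rho_u(\gamma)^{-1}$ of $\pi_1(M)$. Write $H^1(M;\mathfrak v_u)=H^1(\pi_1(M);\mathfrak v_u)$ and $H^1(F;\mathfrak v_u)=H^1(F_2;\mathfrak v_u)$ for group cohomology ($M$ and $F$ are aspherical), and let $x$ act on $H^1(F_2;\mathfrak v_u)$ through $(xf)(h)=x\,f(x^{-1}hx)$ on crossed homomorphisms $f$. Then for every point $u$ of hyperbolic Dehn filling space: 1. $\dim_{\mathbb R} H^1(F;\mathfrak v_u)=9$; 2. the restriction map $H^1(M;\mathfrak v_u)\to H^1(F;\mathfrak v_u)$ is injective, and it is an isomorphism of $H^1(M;\mathfrak v_u)$ onto the subspace $H^1(F_2;\mathfrak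 v_u)^x$ of classes fixed by $x$; 3. $\dim_{\mathbb R} H^1(M;\mathfrak v_u)=1$ if and only if there is exactly one line (one-dimensional subspace) in $H^1(F_2;\mathfrak v_u)$ that is fixed pointwise by $x$. Moreover, the set of points of hyperbolic Dehn filling space at which $\dim_{\mathbb R} H^1(M;\mathfrak v_u)=1$ is open, both in $\mathcal D\subset\mathbb C^2$ and in terms of the coordinate $u\in\mathbb C$. -/

import Mathlib

namespace FigureEight

open Matrix

/-! ### The knot group and its fibre subgroup -/

/-- The relator of the knot group: with `a = x y⁻¹ x⁻¹ y`, the relation `a x = y a`. -/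
def knotRelators : Set (FreeGroup (Fin 2)) :=
  let x := FreeGroup.of (0 : Fin 2)
  let y := FreeGroup.of (1 : Fin 2)
  let a := x * y⁻¹ * x⁻¹ * y
  {a * x * (y * a)⁻¹}

/-- The fundamental group `π₁(M) = ⟨x, y ∣ a x = y a⟩`, `a = x y⁻¹ x⁻¹ y`, of the figure-eight knot
complement `M`. -/
abbrev KnotGroup : Type := PresentedGroup knotRelators

namespace KnotGroup

/-- The meridian `x`. -/
def x : KnotGroup := PresentedGroup.of 0

/-- The second generator `y`. -/
def y : KnotGroup := PresentedGroup.of 1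

/-- The element `a = x y⁻¹ x⁻¹ y`. -/
def a : KnotGroup := x * y⁻¹ * x⁻¹ * y

/-- The element `b = x y⁻¹`. -/
def b : KnotGroup := x * y⁻¹

/-- The fundamental group `⟨a, b⟩` of the once-punctured torus fibre `F` of `M → S¹`. -/
def fiber : Subgroup KnotGroup := Subgroup.closure {a, b}

theorem a_mul_x : a * x = y * a := by
  have h : (PresentedGroup.mk knotRelators) _ = 1 :=
    PresentedGroup.one_of_mem (rels := knotRelators) (Set.mem_singleton _)
  simp only [map_mul, map_inv] at h
  exact mul_inv_eq_one.1 h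

theorem y_eq : y = b⁻¹ * x := by simp [b]

theorem conj_a : x * a * x⁻¹ = b * a := by
  have h := a_mul_x
  rw [y_eq] at h
  rw [mul_inv_eq_iff_eq_mul, mul_assoc b, h]
  group

theorem conj_inv_b : x⁻¹ * b * x = a⁻¹ * b := by
  simp [a, b, mul_assoc]

theorem conj_inv_a : x⁻¹ * a * x = b⁻¹ * a * a := by
  rw [mul_assoc, a_mul_x, y_eq]
  have h := conj_inv_b
  have : x⁻¹ * b⁻¹ * x = b⁻¹ * a := by
    have := congrArg (·⁻¹) h
    simpa [mul_assoc] using this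
  rw [← this]
  group

theorem conj_b : x * b * x⁻¹ = b * a * b := by
  have h : b = (x * a * x⁻¹)⁻¹ * (x * b * x⁻¹) := by
    have h1 : b = x * (x⁻¹ * b * x) * x⁻¹ := by group
    rw [conj_inv_b] at h1
    conv_lhs => rw [h1]
    group
  rw [conj_a, eq_inv_mul_iff_mul_eq] at h
  exact h.symm

/-- The fibre group is normal, since `x a x⁻¹ = b a`, `x b x⁻¹ = b a b`, `x⁻¹ a x = b⁻¹ a²`,
`x⁻¹ b x = a⁻¹ b`. -/
instance fiber_normal : fiber.Normal := by
  have ha : a ∈ fiber := Subgroup.subset_closure (by simp)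
  have hb : b ∈ fiber := Subgroup.subset_closure (by simp)
  have h1 : ∀ h ∈ fiber, x * h * x⁻¹ ∈ fiber := by
    have : fiber ≤ fiber.comap (MulAut.conj x).toMonoidHom := by
      refine (Subgroup.closure_le _).2 ?_
      rintro h (rfl | rfl)
      · change x * a * x⁻¹ ∈ fiber
        rw [conj_a]; exact mul_mem hb ha
      · change x * b * x⁻¹ ∈ fiber
        rw [conj_b]; exact mul_mem (mul_mem hb ha) hb
    exact fun h hh => this hh
  have h2 : ∀ h ∈ fiber, x⁻¹ * h * x ∈ fiber := by
    have : fiber ≤ fiber.comap (MulAut.conj x⁻¹).toMonoidHom := by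
      refine (Subgroup.closure_le _).2 ?_
      rintro h (rfl | rfl)
      · change x⁻¹ * a * x⁻¹⁻¹ ∈ fiber
        rw [inv_inv, conj_inv_a]; exact mul_mem (mul_mem (inv_mem hb) ha) ha
      · change x⁻¹ * b * x⁻¹⁻¹ ∈ fiber
        rw [inv_inv, conj_inv_b]; exact mul_mem (inv_mem ha) hb
    intro h hh
    simpa using this hh
  have hx : x ∈ Subgroup.normalizer (fiber : Set KnotGroup) := by
    rw [Subgroup.mem_normalizer_iff]
    refine fun h => ⟨h1 h, fun hh => ?_⟩
    simpa [mul_assoc] using h2 _ hh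
  have hy : y ∈ Subgroup.normalizer (fiber : Set KnotGroup) := by
    rw [y_eq]
    exact mul_mem (inv_mem (Subgroup.le_normalizer hb)) hx
  rw [← Subgroup.normalizer_eq_top_iff, eq_top_iff,
    ← PresentedGroup.closure_range_of knotRelators, Subgroup.closure_le]
  rintro _ ⟨i, rfl⟩
  fin_cases i
  · exact hx
  · exact hy

end KnotGroup

/-! ### Shapes of the two ideal tetrahedra -/

/-- The hyperbolic Dehn filling space of the figure-eight knot complement: pairs `(z₁, z₂)` of shapes
of positively oriented ideal tetrahedra that satisfy the two (logarithmic) edge equations. -/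
def DehnFillingSpace : Set (ℂ × ℂ) :=
  {z | 0 < z.1.im ∧ 0 < z.2.im ∧
    2 * Complex.log z.1 + Complex.log (1 / (1 - z.1)) +
      Complex.log z.2 + 2 * Complex.log (1 - 1 / z.2) = 2 * Real.pi * Complex.I ∧
    Complex.log (1 / (1 - z.1)) + 2 * Complex.log (1 - 1 / z.1) +
      Complex.log z.2 + 2 * Complex.log (1 / (1 - z.2)) = 2 * Real.pi * Complex.I}

/-- The complex length `u = Log (z₁ (1 - z₂))` of the meridian. Both `arg z₁ ∈ (0, π)` and
`arg (1 - z₂) ∈ (-π, 0)`, so that the principal branch is continuous on `DehnFillingSpace`; it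
vanishes at the complete structure `z₁ = z₂ = exp (π i / 3)`. -/
noncomputable def meridianLength (z : DehnFillingSpace) : ℂ :=
  Complex.log (z.1.1 * (1 - z.1.2))

theorem ne_zero_of_im_pos {w : ℂ} (h : 0 < w.im) : w ≠ 0 ∧ 1 - w ≠ 0 := by
  constructor
  · rintro rfl; simp at h
  · intro h0
    have := congrArg Complex.im h0
    simp at this
    linarith

theorem shape_ne_zero (z : DehnFillingSpace) : z.1.1 * (1 - z.1.2) ≠ 0 :=
  mul_ne_zero (ne_zero_of_im_pos z.2.1).1 (ne_zero_of_im_pos z.2.2.1).2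

/-- The edge equation without logarithms. -/
theorem edge_equation (z : DehnFillingSpace) :
    (z.1.1 * (1 - z.1.2)) ^ 2 = (1 - z.1.1) * z.1.2 := by
  obtain ⟨⟨z, w⟩, hz, hw, h, -⟩ := z
  obtain ⟨hz0, hz1⟩ := ne_zero_of_im_pos hz
  obtain ⟨hw0, hw1⟩ := ne_zero_of_im_pos hw
  simp only at *
  have h2 : (1 : ℂ) - 1 / w ≠ 0 := by
    have : (1 : ℂ) - 1 / w = -((1 - w) / w) := by field_simp; ring
    rw [this]; exact neg_ne_zero.2 (div_ne_zero hw1 hw0)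
  have := congrArg Complex.exp h
  rw [Complex.exp_two_pi_mul_I, Complex.exp_add, Complex.exp_add, Complex.exp_add, two_mul, two_mul,
    Complex.exp_add, Complex.exp_add, Complex.exp_log hz0, Complex.exp_log hw0, Complex.exp_log h2,
    Complex.exp_log (one_div_ne_zero hz1)] at this
  field_simp at this
  linear_combination this

/-! ### The holonomy in `SL(2, ℂ)` -/

/-- A square root of `z₁ (1 - z₂)`. -/
noncomputable def sqrtHol (z : DehnFillingSpace) : ℂ := Complex.exp (meridianLength z / 2)

theorem sqrtHol_sq (z : DehnFillingSpace) : sqrtHol z ^ 2 = z.1.1 * (1 - z.1.2) := by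
  rw [sqrtHol, ← Complex.exp_nat_mul]
  convert Complex.exp_log (shape_ne_zero z) using 2
  rw [meridianLength]; push_cast; ring

theorem sqrtHol_ne_zero (z : DehnFillingSpace) : sqrtHol z ≠ 0 := Complex.exp_ne_zero _

/-- The gluing isometry `x`: the Möbius map with `∞ ↦ ∞`, `1 ↦ 0`, `z₁ ↦ z₁ (1 - 1 / z₂)`. -/
noncomputable def slX (z : DehnFillingSpace) : Matrix.SpecialLinearGroup (Fin 2) ℂ :=
  ⟨!![(sqrtHol z)⁻¹, -(sqrtHol z)⁻¹; 0, sqrtHol z], by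
    have := sqrtHol_ne_zero z
    simp [Matrix.det_fin_two_of, this]⟩

/-- The gluing isometry `y`: the Möbius map with `0 ↦ 0`, `1 ↦ z₁`, `∞ ↦ z₁ (1 - 1 / z₂)`. -/
noncomputable def slY (z : DehnFillingSpace) : Matrix.SpecialLinearGroup (Fin 2) ℂ :=
  ⟨!![sqrtHol z, 0; -z.1.2 * (sqrtHol z)⁻¹, (sqrtHol z)⁻¹], by
    have := sqrtHol_ne_zero z
    simp [Matrix.det_fin_two_of, this]⟩

theorem sl_relation (z : DehnFillingSpace) :
    slX z * (slY z)⁻¹ * (slX z)⁻¹ * slY z * slX z =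
      slY z * (slX z * (slY z)⁻¹ * (slX z)⁻¹ * slY z) := by
  have hs := sqrtHol_ne_zero z
  have h1 := sqrtHol_sq z
  have h2 := edge_equation z
  have hw1 := (ne_zero_of_im_pos z.2.2.1).2
  have h3 : z.1.2 ^ 2 - (sqrtHol z ^ 4 - sqrtHol z ^ 2 + 1) * z.1.2 + sqrtHol z ^ 4 = 0 := by
    rw [← h1] at h2
    linear_combination (1 - z.1.2) * h2 + z.1.2 * h1
  have hX : (slX z : Matrix (Fin 2) (Fin 2) ℂ) =
    !![(sqrtHol z)⁻¹, -(sqrtHol z)⁻¹; 0, sqrtHol z] := rfl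
  have hY : (slY z : Matrix (Fin 2) (Fin 2) ℂ) =
    !![sqrtHol z, 0; -z.1.2 * (sqrtHol z)⁻¹, (sqrtHol z)⁻¹] := rfl
  refine (Matrix.SpecialLinearGroup.ext_iff _ _).2 fun i j => ?_
  simp only [Matrix.SpecialLinearGroup.coe_mul, Matrix.SpecialLinearGroup.coe_inv]
  rw [hX, hY]
  simp only [Matrix.adjugate_fin_two_of, Matrix.mul_fin_two]
  clear hX hY
  generalize z.1.2 = w at *
  generalize sqrtHol z = s at *
  fin_cases i <;> fin_cases j <;>
  simp <;> field_simp
  · linear_combination (1 - s ^ 2) * h3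
  · linear_combination -h3
  · linear_combination w * h3
  · linear_combination (s ^ 2 - 1) * h3

/-- The holonomy `π₁(M) → SL(2, ℂ)` of the structure with shapes `z`. -/
noncomputable def slHol (z : DehnFillingSpace) : KnotGroup →* Matrix.SpecialLinearGroup (Fin 2) ℂ :=
  PresentedGroup.toGroup (f := ![slX z, slY z]) (by
    rintro r rfl
    simp only [map_mul, map_inv, FreeGroup.lift_apply_of]
    exact mul_inv_eq_one.2 (sl_relation z))

/-! ### From `SL(2, ℂ)` to the isometries of the Klein model -/

/-- The Hermitian matrix with Lorentz coordinates `(X, Y, Z, W)`. The point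
`[4 Re p : 4 Im p : 4 - |p|² : 4 + |p|²]` of the boundary sphere of the Klein model that corresponds
to `p ∈ ∂ℍ³ = ℂ ∪ {∞}` goes to the Hermitian square of `(p, 1)`. -/
noncomputable def herm : (Fin 4 → ℝ) →ₗ[ℝ] Matrix (Fin 2) (Fin 2) ℂ where
  toFun p := !![(((p 3 - p 2) / 2 : ℝ) : ℂ), ((p 0 / 4 : ℝ) : ℂ) + ((p 1 / 4 : ℝ) : ℂ) * Complex.I;
    ((p 0 / 4 : ℝ) : ℂ) - ((p 1 / 4 : ℝ) : ℂ) * Complex.I, (((p 3 + p 2) / 8 : ℝ) : ℂ)]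
  map_add' p q := by
    ext i j
    fin_cases i <;> fin_cases j <;> simp <;> ring
  map_smul' c p := by
    ext i j
    fin_cases i <;> fin_cases j <;> simp <;> ring

/-- The Lorentz coordinates of a Hermitian matrix. -/
noncomputable def coords : Matrix (Fin 2) (Fin 2) ℂ →ₗ[ℝ] (Fin 4 → ℝ) where
  toFun H := ![4 * (H 0 1).re, 4 * (H 0 1).im, 4 * (H 1 1).re - (H 0 0).re,
    4 * (H 1 1).re + (H 0 0).re]
  map_add' p q := by
    ext i
    fin_cases i <;> simp <;> ring
  map_smul' c p := by
    ext i
    fin_cases i <;> simp <;> ring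

theorem coords_herm (p : Fin 4 → ℝ) : coords (herm p) = p := by
  ext i
  fin_cases i <;> simp [coords, herm] <;> ring

theorem herm_coords {H : Matrix (Fin 2) (Fin 2) ℂ} (hH : H.IsHermitian) : herm (coords H) = H := by
  have h00 := congrArg Complex.im (hH.apply 0 0)
  have h11 := congrArg Complex.im (hH.apply 1 1)
  have h10 := hH.apply 1 0
  simp at h00 h11
  have e00 : (H 0 0).im = 0 := by linarith
  have e11 : (H 1 1).im = 0 := by linarith
  ext i j
  fin_cases i <;> fin_cases j
  · apply Complex.ext <;> simp [coords, herm, e00]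
  · apply Complex.ext <;> simp [coords, herm]
  · change _ = H 1 0
    rw [← h10]
    apply Complex.ext <;> simp [coords, herm]
  · apply Complex.ext <;> simp [coords, herm, e11]
    ring

theorem herm_isHermitian (p : Fin 4 → ℝ) : (herm p).IsHermitian := by
  refine Matrix.IsHermitian.ext fun i j => ?_
  fin_cases i <;> fin_cases j <;> simp [herm]
  all_goals ring

/-- The map `H ↦ g H gᴴ` in Lorentz coordinates. -/
noncomputable def hermAction (g : Matrix (Fin 2) (Fin 2) ℂ) : (Fin 4 → ℝ) →ₗ[ℝ] (Fin 4 → ℝ) where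
  toFun p := coords (g * herm p * gᴴ)
  map_add' p q := by simp [Matrix.mul_add, Matrix.add_mul]
  map_smul' c p := by simp

/-- The action of `2 × 2` complex matrices on `ℝ^{3,1}`. -/
noncomputable def kleinMatrix : Matrix (Fin 2) (Fin 2) ℂ →* Matrix (Fin 4) (Fin 4) ℝ where
  toFun g := LinearMap.toMatrix' (hermAction g)
  map_one' := by
    have : hermAction 1 = LinearMap.id := by
      refine LinearMap.ext fun p => ?_
      simp [hermAction, coords_herm]
    rw [this, LinearMap.toMatrix'_id]
  map_mul' g h := by
    rw [← LinearMap.toMatrix'_comp]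
    congr 1
    refine LinearMap.ext fun p => ?_
    have hh : (h * herm p * hᴴ).IsHermitian :=
      Matrix.isHermitian_mul_mul_conjTranspose h (herm_isHermitian p)
    change coords _ = coords (g * herm (coords (h * herm p * hᴴ)) * gᴴ)
    rw [herm_coords hh]
    simp [Matrix.mul_assoc]

/-- The holonomy `ρ : π₁(M) → SO(3, 1) ⊆ GL(4, ℝ)`. -/
noncomputable def hol (z : DehnFillingSpace) : KnotGroup →* GL (Fin 4) ℝ :=
  ((Units.map kleinMatrix).comp Matrix.SpecialLinearGroup.toGL).comp (slHol z)

/-- The Lorentz form. -/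
def lorentz : Matrix (Fin 4) (Fin 4) ℝ := Matrix.diagonal ![1, 1, 1, -1]

theorem lorentz_eq_det (p : Fin 4 → ℝ) :
    ((p ⬝ᵥ lorentz *ᵥ p : ℝ) : ℂ) = -16 * (herm p).det := by
  simp [lorentz, herm, Matrix.det_fin_two, dotProduct, Matrix.mulVec_diagonal, Fin.sum_univ_four]
  linear_combination (p 1 : ℂ) ^ 2 * Complex.I_sq

theorem eq_of_quadratic {A B : Matrix (Fin 4) (Fin 4) ℝ} (hA : Aᵀ = A) (hB : Bᵀ = B)
    (h : ∀ p, p ⬝ᵥ A *ᵥ p = p ⬝ᵥ B *ᵥ p) : A = B := by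
  ext i j
  have h1 := h (Pi.single i 1)
  have h2 := h (Pi.single j 1)
  have h3 := h (Pi.single i 1 + Pi.single j 1)
  have hA' : A j i = A i j := congrFun (congrFun hA i) j
  have hB' : B j i = B i j := congrFun (congrFun hB i) j
  simp [Matrix.mulVec_add, add_dotProduct, dotProduct_add, hA', hB'] at h1 h2 h3
  linarith

theorem kleinMatrix_lorentz {g : Matrix (Fin 2) (Fin 2) ℂ} (hg : g.det = 1) :
    (kleinMatrix g)ᵀ * lorentz * kleinMatrix g = lorentz := by
  have hl : lorentzᵀ = lorentz := Matrix.diagonal_transpose _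
  refine eq_of_quadratic (by simp [Matrix.mul_assoc, hl]) hl fun p => ?_
  have h1 : p ⬝ᵥ ((kleinMatrix g)ᵀ * lorentz * kleinMatrix g) *ᵥ p =
      (kleinMatrix g *ᵥ p) ⬝ᵥ lorentz *ᵥ (kleinMatrix g *ᵥ p) := by
    rw [← Matrix.mulVec_mulVec, ← Matrix.mulVec_mulVec, Matrix.dotProduct_mulVec,
      Matrix.vecMul_transpose]
  have h2 : kleinMatrix g *ᵥ p = coords (g * herm p * gᴴ) := by
    change LinearMap.toMatrix' (hermAction g) *ᵥ p = _
    rw [LinearMap.toMatrix'_mulVec]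
    rfl
  rw [h1, h2]
  apply Complex.ofReal_injective
  rw [lorentz_eq_det, lorentz_eq_det,
    herm_coords (Matrix.isHermitian_mul_mul_conjTranspose g (herm_isHermitian p))]
  simp [Matrix.det_mul, Matrix.det_conjTranspose, hg]

/-- The holonomy preserves the Lorentz form. -/
theorem hol_lorentz (z : DehnFillingSpace) (γ : KnotGroup) :
    (hol z γ : Matrix (Fin 4) (Fin 4) ℝ)ᵀ * lorentz * (hol z γ : Matrix (Fin 4) (Fin 4) ℝ) =
      lorentz :=
  kleinMatrix_lorentz (slHol z γ).2

/-- The holonomy of `x` as an explicit matrix in the shapes. -/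
theorem hol_x (z : DehnFillingSpace) :
    letI m : ℂ := z.1.1 * (1 - z.1.2)
    (hol z KnotGroup.x : Matrix (Fin 4) (Fin 4) ℝ) = (8 * ‖m‖)⁻¹ •
      !![8 * m.re, 8 * m.im, -4 * m.re, -4 * m.re;
        -8 * m.im, 8 * m.re, 4 * m.im, 4 * m.im;
        4, 0, 3 + 4 * ‖m‖ ^ 2, -5 + 4 * ‖m‖ ^ 2;
        -4, 0, -3 + 4 * ‖m‖ ^ 2, 5 + 4 * ‖m‖ ^ 2] := by
  have hs := sqrtHol_ne_zero z
  simp only [← sqrtHol_sq z]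
  have hm : (hol z KnotGroup.x : Matrix (Fin 4) (Fin 4) ℝ) = kleinMatrix (slX z).1 := by
    simp [hol, slHol, KnotGroup.x]
  rw [hm, norm_pow, ← Complex.normSq_eq_norm_sq]
  simp only [slX]
  generalize sqrtHol z = s at *
  obtain ⟨p, q⟩ := s
  have hN : p * p + q * q ≠ 0 := by
    have := (Complex.normSq_pos.2 hs).ne'
    simpa [Complex.normSq_apply] using this
  have hN' : p ^ 2 + q ^ 2 ≠ 0 := by rwa [pow_two, pow_two]
  have hi : (⟨p, q⟩ : ℂ)⁻¹ = ⟨p / (p ^ 2 + q ^ 2), -q / (p ^ 2 + q ^ 2)⟩ := by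
    apply Complex.ext <;> simp [Complex.normSq_apply, pow_two]
  rw [hi]
  ext i j
  change coords _ i = _
  fin_cases i <;> fin_cases j <;>
  simp [coords, herm, Matrix.vecMul, dotProduct, Fin.sum_univ_two, Complex.normSq_apply, pow_two,
    Complex.inv_re, Complex.inv_im] <;> field_simp <;> ring

/-- The holonomy of `y` as an explicit matrix in the shapes. -/
theorem hol_y (z : DehnFillingSpace) :
    letI m : ℂ := z.1.1 * (1 - z.1.2)
    letI w : ℂ := m * star z.1.2
    (hol z KnotGroup.y : Matrix (Fin 4) (Fin 4) ℝ) = (2 * ‖m‖)⁻¹ •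
      !![2 * m.re, -2 * m.im, 4 * w.re, -4 * w.re;
        2 * m.im, 2 * m.re, 4 * w.im, -4 * w.im;
        -4 * z.1.2.re, 4 * z.1.2.im, 1 - 4 * ‖z.1.2‖ ^ 2 + ‖m‖ ^ 2, 1 + 4 * ‖z.1.2‖ ^ 2 - ‖m‖ ^ 2;
        -4 * z.1.2.re, 4 * z.1.2.im, 1 - 4 * ‖z.1.2‖ ^ 2 - ‖m‖ ^ 2,
          1 + 4 * ‖z.1.2‖ ^ 2 + ‖m‖ ^ 2] := by
  have hs := sqrtHol_ne_zero z
  simp only [← sqrtHol_sq z]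
  have hm : (hol z KnotGroup.y : Matrix (Fin 4) (Fin 4) ℝ) = kleinMatrix (slY z).1 := by
    simp [hol, slHol, KnotGroup.y]
  rw [hm, norm_pow, ← Complex.normSq_eq_norm_sq, ← Complex.normSq_eq_norm_sq]
  simp only [slY]
  generalize sqrtHol z = s at *
  obtain ⟨c, d⟩ := z.1.2
  obtain ⟨p, q⟩ := s
  have hN : p * p + q * q ≠ 0 := by
    have := (Complex.normSq_pos.2 hs).ne'
    simpa [Complex.normSq_apply] using this
  have hN' : p ^ 2 + q ^ 2 ≠ 0 := by rwa [pow_two, pow_two]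
  have hi : (⟨p, q⟩ : ℂ)⁻¹ = ⟨p / (p ^ 2 + q ^ 2), -q / (p ^ 2 + q ^ 2)⟩ := by
    apply Complex.ext <;> simp [Complex.normSq_apply, pow_two]
  rw [hi]
  ext i j
  change coords _ i = _
  fin_cases i <;> fin_cases j <;>
  simp [coords, herm, Matrix.vecMul, dotProduct, Fin.sum_univ_two, Complex.normSq_apply, pow_two,
    Complex.inv_re, Complex.inv_im] <;> field_simp <;> ring



/-! ### The coefficient module -/

section Coefficients

attribute [local instance 100] LieRing.ofAssociativeRing

/-- The Lie algebra `𝔰𝔩(4, ℝ)`. -/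
abbrev sl4 : LieSubalgebra ℝ (Matrix (Fin 4) (Fin 4) ℝ) := LieAlgebra.SpecialLinear.sl (Fin 4) ℝ

/-- The Lie algebra `𝔰𝔬(3, 1)`. -/
def so31 : LieSubalgebra ℝ (Matrix (Fin 4) (Fin 4) ℝ) := skewAdjointMatricesLieSubalgebra lorentz

/-- The module `𝔳`: the orthogonal complement of `𝔰𝔬(3, 1)` in `𝔰𝔩(4, ℝ)` for the Killing form. -/
noncomputable def vModule : Submodule ℝ (Matrix (Fin 4) (Fin 4) ℝ) :=
  (LinearMap.BilinForm.orthogonal (killingForm ℝ sl4)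
    (so31.toSubmodule.comap sl4.toSubmodule.subtype)).map sl4.toSubmodule.subtype

theorem killingForm_sl4 (A B : sl4) :
    killingForm ℝ sl4 A B = 8 * ((A : Matrix (Fin 4) (Fin 4) ℝ) * B).trace := by
  have hA : (A : Matrix (Fin 4) (Fin 4) ℝ).trace = 0 := A.2
  let φ : Matrix (Fin 4) (Fin 4) ℝ →ₗ[ℝ] Matrix (Fin 4) (Fin 4) ℝ :=
    (LieAlgebra.ad ℝ _ (A : Matrix (Fin 4) (Fin 4) ℝ)) ∘ₗ
      (LieAlgebra.ad ℝ _ (B : Matrix (Fin 4) (Fin 4) ℝ))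
  have hφ : ∀ X, φ X = A * (B * X - X * B) - (B * X - X * B) * A := fun X => rfl
  have hmem : ∀ X, φ X ∈ sl4.toSubmodule := fun X => by
    change (φ X).trace = 0
    rw [hφ, Matrix.trace_sub, Matrix.trace_mul_comm, sub_self]
  have h1 := LinearMap.trace_restrict_eq_of_forall_mem sl4.toSubmodule φ hmem
  have h2 : killingForm ℝ sl4 A B = LinearMap.trace ℝ _ φ := by
    rw [← h1, LieModule.traceForm_apply_apply]
    rfl
  rw [h2, LinearMap.trace_eq_matrix_trace ℝ (Matrix.stdBasis ℝ (Fin 4) (Fin 4)), Matrix.trace,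
    Fintype.sum_prod_type]
  have h3 : ∀ i j : Fin 4, (LinearMap.toMatrix (Matrix.stdBasis ℝ (Fin 4) (Fin 4))
      (Matrix.stdBasis ℝ (Fin 4) (Fin 4)) φ).diag (i, j) =
      (A * B : Matrix (Fin 4) (Fin 4) ℝ) i i - A.1 i i * B.1 j j - B.1 i i * A.1 j j +
        (B * A : Matrix (Fin 4) (Fin 4) ℝ) j j := by
    intro i j
    rw [Matrix.diag_apply, LinearMap.toMatrix_apply, Matrix.stdBasis_eq_single, hφ]
    have hr : ∀ X : Matrix (Fin 4) (Fin 4) ℝ,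
        (Matrix.stdBasis ℝ (Fin 4) (Fin 4)).repr X (i, j) = X i j := fun X => by
      simp [Matrix.stdBasis]
    rw [hr]
    have e : ∀ P Q : Matrix (Fin 4) (Fin 4) ℝ,
        (P * Matrix.single i j (1 : ℝ) * Q : Matrix (Fin 4) (Fin 4) ℝ) i j = P i i * Q j j := fun P Q => by
      simp [Matrix.mul_apply, Matrix.single_apply, ite_and]
    simp only [Matrix.mul_sub, Matrix.sub_mul, ← Matrix.mul_assoc, Matrix.sub_apply, e]
    rw [Matrix.mul_assoc (Matrix.single i j 1)]
    simp
    ring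
  simp only [h3]
  simp only [Matrix.trace, Matrix.diag_apply, Fin.sum_univ_four, Matrix.mul_apply] at hA ⊢
  linear_combination (-2 * (B.1 0 0 + B.1 1 1 + B.1 2 2 + B.1 3 3)) * hA

/-- Elementwise: `𝔳` consists of the trace-free matrices that are self-adjoint for the Lorentz
form. -/
theorem mem_vModule {A : Matrix (Fin 4) (Fin 4) ℝ} :
    A ∈ vModule ↔ A.trace = 0 ∧ Aᵀ * lorentz = lorentz * A := by
  have hJt : lorentzᵀ = lorentz := Matrix.diagonal_transpose _
  have hJJ : lorentz * lorentz = 1 := by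
    rw [lorentz, Matrix.diagonal_mul_diagonal, ← Matrix.diagonal_one]
    congr 1
    ext i
    fin_cases i <;> simp
  have hso : ∀ C : Matrix (Fin 4) (Fin 4) ℝ, C ∈ so31 ↔ Cᵀ * lorentz = -(lorentz * C) := fun C => by
    rw [so31, mem_skewAdjointMatricesLieSubalgebra, mem_skewAdjointMatricesSubmodule,
      Matrix.IsSkewAdjoint, Matrix.IsAdjointPair, Matrix.mul_neg]
  have htr : ∀ C : Matrix (Fin 4) (Fin 4) ℝ, C ∈ so31 → C.trace = 0 := fun C hC => by
    have h : Cᵀ = -(lorentz * C * lorentz) := by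
      rw [← Matrix.neg_mul, ← (hso C).1 hC, Matrix.mul_assoc, hJJ, Matrix.mul_one]
    have h1 : Cᵀ.trace = -C.trace := by
      rw [h, Matrix.trace_neg, Matrix.mul_assoc, Matrix.trace_mul_comm, Matrix.mul_assoc, hJJ,
        Matrix.mul_one]
    rw [Matrix.trace_transpose] at h1
    linarith
  constructor
  · rintro ⟨B, hB, rfl⟩
    refine ⟨B.2, ?_⟩
    have h : ∀ C ∈ so31, (C * (B : Matrix (Fin 4) (Fin 4) ℝ)).trace = 0 := fun C hC => by
      have := hB ⟨C, htr C hC⟩ hC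
      rw [killingForm_sl4] at this
      simpa using this
    change (B : Matrix (Fin 4) (Fin 4) ℝ)ᵀ * lorentz = lorentz * (B : Matrix (Fin 4) (Fin 4) ℝ)
    generalize (B : Matrix (Fin 4) (Fin 4) ℝ) = A at *
    set S := A * lorentz with hS
    set K := Sᵀ - S with hK
    have hKt : Kᵀ = -K := by simp [hK]
    have h1 : (K * S).trace = 0 := by
      have := h (lorentz * K) ((hso _).2 (by
        rw [Matrix.transpose_mul, hJt, hKt, Matrix.mul_assoc, hJJ, ← Matrix.mul_assoc, hJJ]
        simp))
      rwa [Matrix.mul_assoc, Matrix.trace_mul_comm, Matrix.mul_assoc] at this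
    have h2 : (K * Sᵀ).trace = 0 := by
      rw [← Matrix.trace_transpose, Matrix.transpose_mul, Matrix.transpose_transpose, hKt,
        Matrix.mul_neg, Matrix.trace_neg, Matrix.trace_mul_comm, h1, neg_zero]
    have h3 : (Kᴴ * K).trace = 0 := by
      rw [Matrix.conjTranspose_eq_transpose_of_trivial, hKt]
      nth_rewrite 2 [hK]
      rw [Matrix.mul_sub, Matrix.trace_sub]
      simp [h1, h2]
    have h4 : Sᵀ = S := sub_eq_zero.1 (Matrix.trace_conjTranspose_mul_self_eq_zero_iff.1 h3)
    rw [hS, Matrix.transpose_mul, hJt] at h4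
    calc Aᵀ * lorentz = lorentz * (lorentz * Aᵀ) * lorentz := by rw [← Matrix.mul_assoc, hJJ]; simp
      _ = lorentz * A := by rw [h4, Matrix.mul_assoc, Matrix.mul_assoc, hJJ, Matrix.mul_one]
  · rintro ⟨h0, hA⟩
    refine ⟨⟨A, h0⟩, fun C hC => ?_, rfl⟩
    refine (killingForm_sl4 C ⟨A, h0⟩).trans ?_
    have hC' := (hso C.1).1 hC
    change 8 * (C.1 * A).trace = 0
    have h1 : (C.1 * A).trace = -(C.1 * A).trace := by
      calc (C.1 * A).trace = (Aᵀ * C.1ᵀ).trace := by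
            rw [← Matrix.trace_transpose, Matrix.transpose_mul]
        _ = (Aᵀ * (C.1ᵀ * lorentz) * lorentz).trace := by
            rw [Matrix.mul_assoc, Matrix.mul_assoc, hJJ, Matrix.mul_one]
        _ = -(Aᵀ * lorentz * (C.1 * lorentz)).trace := by
            rw [hC']; simp [Matrix.mul_assoc]
        _ = -((A * C.1) * (lorentz * lorentz)).trace := by
            rw [hA, Matrix.mul_assoc, Matrix.trace_mul_comm]
            simp [Matrix.mul_assoc]
        _ = -(C.1 * A).trace := by rw [hJJ, Matrix.mul_one, Matrix.trace_mul_comm]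
    linarith

end Coefficients

theorem conj_mem_vModule (z : DehnFillingSpace) (γ : KnotGroup) {A : Matrix (Fin 4) (Fin 4) ℝ}
    (hA : A ∈ vModule) :
    (hol z γ : Matrix (Fin 4) (Fin 4) ℝ) * A * ((hol z γ)⁻¹ : GL (Fin 4) ℝ) ∈ vModule := by
  obtain ⟨h0, h1⟩ := mem_vModule.1 hA
  have hg := hol_lorentz z γ
  have e1 : ((hol z γ)⁻¹ : GL (Fin 4) ℝ).1 * (hol z γ).1 = 1 := (hol z γ).inv_mul
  have e2 : (hol z γ).1 * ((hol z γ)⁻¹ : GL (Fin 4) ℝ).1 = 1 := (hol z γ).mul_inv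
  rw [mem_vModule]
  generalize ((hol z γ)⁻¹ : GL (Fin 4) ℝ).1 = k at *
  generalize (hol z γ).1 = g at *
  refine ⟨by rw [Matrix.trace_mul_comm, ← Matrix.mul_assoc, e1, Matrix.one_mul, h0], ?_⟩
  have e3 : kᵀ * gᵀ = 1 := by rw [← Matrix.transpose_mul, e2, Matrix.transpose_one]
  have e4 : gᵀ * lorentz = lorentz * k := by
    rw [← hg, Matrix.mul_assoc _ g k, e2, Matrix.mul_one, hg]
  have e5 : kᵀ * lorentz = lorentz * g := by
    rw [← hg, ← Matrix.mul_assoc, ← Matrix.mul_assoc, e3, Matrix.one_mul, hg]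
  calc (g * A * k)ᵀ * lorentz = kᵀ * (Aᵀ * (gᵀ * lorentz)) := by
        simp [Matrix.transpose_mul, Matrix.mul_assoc]
    _ = kᵀ * lorentz * (A * k) := by
        rw [e4, ← Matrix.mul_assoc Aᵀ, h1]; simp [Matrix.mul_assoc]
    _ = lorentz * (g * A * k) := by rw [e5]; simp [Matrix.mul_assoc]

/-- The representation `Ad ρ` of `π₁(M)` on `𝔳`: `γ` acts by `A ↦ ρ(γ) A ρ(γ)⁻¹`. -/
noncomputable def adRep (z : DehnFillingSpace) : Representation ℝ KnotGroup vModule where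
  toFun γ :=
    { toFun := fun A => ⟨hol z γ * A.1 * ((hol z γ)⁻¹ : GL (Fin 4) ℝ), conj_mem_vModule z γ A.2⟩
      map_add' := fun A B => Subtype.ext (by simp [Matrix.mul_add, Matrix.add_mul])
      map_smul' := fun c A => Subtype.ext (by simp) }
  map_one' := by
    ext1 A
    exact Subtype.ext (by simp)
  map_mul' γ δ := by
    ext1 A
    exact Subtype.ext (by simp [Matrix.mul_assoc])

/-! ### Cohomology -/

/-- The `π₁(M)`-module `𝔳_u`. -/
noncomputable abbrev vRep (z : DehnFillingSpace) : Rep ℝ KnotGroup := Rep.of (adRep z)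

/-- The restriction of `𝔳_u` to the fibre group. -/
noncomputable abbrev vRepFiber (z : DehnFillingSpace) : Rep ℝ KnotGroup.fiber :=
  Rep.res KnotGroup.fiber.subtype (vRep z)

/-- `H¹(M; 𝔳_u)`. -/
noncomputable abbrev H1M (z : DehnFillingSpace) : ModuleCat ℝ := groupCohomology.H1 (vRep z)

/-- `H¹(F; 𝔳_u)`. -/
noncomputable abbrev H1F (z : DehnFillingSpace) : ModuleCat ℝ := groupCohomology.H1 (vRepFiber z)

open CategoryTheory in
/-- The restriction map `H¹(M; 𝔳_u) → H¹(F; 𝔳_u)`. -/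
noncomputable def resFiber (z : DehnFillingSpace) : H1M z →ₗ[ℝ] H1F z :=
  (groupCohomology.map KnotGroup.fiber.subtype (𝟙 (vRepFiber z)) 1).hom

/-- The automorphism `h ↦ x⁻¹ h x` of the fibre group. -/
def conjFiber : KnotGroup.fiber →* KnotGroup.fiber :=
  (MulAut.conjNormal (H := KnotGroup.fiber) KnotGroup.x⁻¹).toMonoidHom

/-- The action of `x` on `𝔳_u`, which intertwines `x⁻¹ h x` with `h`. -/
noncomputable def coeffMap (z : DehnFillingSpace) :
    Rep.res conjFiber (vRepFiber z) ⟶ vRepFiber z :=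
  Rep.ofHom
    { adRep z KnotGroup.x with
      isIntertwining' := fun h => by
        change adRep z KnotGroup.x * adRep z (conjFiber h) = adRep z h * adRep z KnotGroup.x
        rw [← map_mul, ← map_mul]
        congr 1
        simp [conjFiber, mul_assoc] }

/-- The monodromy action of `x` on `H¹(F; 𝔳_u)`, induced on crossed homomorphisms by
`(x f)(h) = x (f (x⁻¹ h x))`. -/
noncomputable def monodromy (z : DehnFillingSpace) : Module.End ℝ (H1F z) :=
  (groupCohomology.map conjFiber (coeffMap z) 1).hom

/-- The subspace `H¹(F; 𝔳_u)^x` of classes that are fixed by the monodromy. -/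
noncomputable def fixedClasses (z : DehnFillingSpace) : Submodule ℝ (H1F z) :=
  LinearMap.eqLocus (monodromy z) LinearMap.id

end FigureEight

namespace FigureEight

open Matrix

/-! ### Shapes: the ratio of the second shape to the meridian eigenvalue -/

/-! The whole theorem rests on one fact: the fibre group has no nonzero invariants in `𝔳`. With m =
z₁(1 - z₂) and W = z₂/m, the edge equation reads W + 1/W = m + 1/m - 1, and the arguments in its
logarithmic form put W in the upper half-plane (`shapeRatio_im_pos`). In SL(2, ℂ) the elements a, ba
have trace 1 + W, while b, b⁻¹a have trace 1 + 1/W. After complexification ℝ^{3,1} becomes M₂(ℂ)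
with action M ↦ g M gᴴ. If (tr g)² is not real, a linear map commuting with this action of g
commutes with left and with right multiplication separately. One of the two generating pairs always
satisfies this condition, and each pair generates M₂(ℂ) as an algebra; so the commutant consists of
scalars, and a trace-free matrix in it is zero (`eq_zero_of_commute_hol_fiber`).

The fibre group is free on a, b, because π₁(M) maps to F₂ ⋊ ℤ. Its crossed homomorphisms therefore
form `𝔳`², of dimension 18, and the coboundaries have dimension 9, which leaves 9 for H¹(F)
(`finrank_H1F`). Absence of invariants also gives injectivity of restriction, as in the
inflation-restriction sequence (`resFiber_injective`). If x f - f is the coboundary of v, then f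
extends to π₁(M) with value v on x (`exists_resFiber_eq`), so the image is the fixed space.
Statement 3 is then linear algebra.

For openness, H¹(M) never vanishes (`finrank_H1M_pos`): pairing the value on the longitude with a
peripheral invariant is a nonzero functional on H¹(F) fixed by the monodromy. Hence dimension one
means dimension at most one, which is an open condition by semicontinuity of rank
(`isOpen_finrank_ker_le`). It passes to the coordinate u because u is an open map
(`isOpenMap_meridianLength`): W + 1/W is a local homeomorphism off ±1. -/

/-- The ratio `w / m`, with `w = z₂` and `m = z₁ (1 - z₂)`. The traces of the holonomies of `a` and `b`
are `1 + w / m` and `1 + m / w`. -/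
noncomputable def shapeRatio (z : DehnFillingSpace) : ℂ := z.1.2 / (z.1.1 * (1 - z.1.2))

theorem arg_pos_of_im_pos {w : ℂ} (h : 0 < w.im) : 0 < w.arg :=
  lt_of_le_of_ne (Complex.arg_nonneg_iff.2 h.le) fun h0 => h.ne' (Complex.arg_eq_zero_iff.1 h0.symm).2

theorem im_one_div_one_sub_pos {w : ℂ} (h : 0 < w.im) : 0 < (1 / (1 - w)).im := by
  have h1 := Complex.normSq_pos.2 (ne_zero_of_im_pos h).2
  rw [one_div, Complex.inv_im]
  exact div_pos (by simpa using h) h1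

theorem im_one_sub_one_div_pos {w : ℂ} (h : 0 < w.im) : 0 < (1 - 1 / w).im := by
  have h1 := Complex.normSq_pos.2 (ne_zero_of_im_pos h).1
  rw [one_div, Complex.sub_im, Complex.inv_im, Complex.one_im, zero_sub, neg_div, neg_neg]
  exact div_pos h h1

theorem im_mul_pos_of_arg_add_lt {p q : ℂ} (hp : 0 < p.im) (hq : 0 < q.im)
    (h : p.arg + q.arg < Real.pi) : 0 < (p * q).im := by
  have h1 := arg_pos_of_im_pos hp
  have h2 := arg_pos_of_im_pos hq
  have hp0 := (ne_zero_of_im_pos hp).1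
  have hq0 := (ne_zero_of_im_pos hq).1
  have h3 : (p * q).arg = p.arg + q.arg :=
    Complex.arg_mul hp0 hq0 ⟨by linarith [Real.pi_pos], h.le⟩
  rw [← Complex.norm_mul_sin_arg, h3]
  exact mul_pos (norm_pos_iff.2 (mul_ne_zero hp0 hq0)) (Real.sin_pos_of_pos_of_lt_pi (by linarith) h)

/-- The imaginary part of the edge equation makes the ratio `w / m` lie in the upper half-plane. -/
theorem shapeRatio_im_pos (z : DehnFillingSpace) : 0 < (shapeRatio z).im := by
  obtain ⟨⟨v, w⟩, hv, hw, h, -⟩ := z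
  simp only at hv hw h
  have h' := congrArg Complex.im h
  simp only [Complex.add_im, Complex.mul_im, Complex.log_im, Complex.re_ofNat, Complex.im_ofNat,
    Complex.I_im, Complex.I_re, Complex.ofReal_re, Complex.ofReal_im, Complex.mul_re] at h'
  -- In 2 arg v + arg(1/(1-v)) + arg w + 2 arg(1-1/w) = 2π the two unpaired arguments are positive,
  -- so arg v + arg(1-1/w) < π.
  have h1 := arg_pos_of_im_pos (im_one_div_one_sub_pos hv)
  have h2 := arg_pos_of_im_pos hw
  have h3 := im_mul_pos_of_arg_add_lt hv (im_one_sub_one_div_pos hw) (by linarith)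
  have hv0 := ne_zero_of_im_pos hv
  have hw0 := ne_zero_of_im_pos hw
  have h4 : shapeRatio ⟨⟨v, w⟩, hv, hw, h, by assumption⟩ = -(v * (1 - 1 / w))⁻¹ := by
    have e : v * (1 - 1 / w) = -(v * (1 - w)) / w := by
      field_simp [hw0.1]; ring
    rw [e, shapeRatio, neg_div, inv_neg, neg_neg, inv_div]
  rw [h4, Complex.neg_im, Complex.inv_im, neg_div, neg_neg]
  exact div_pos h3 (Complex.normSq_pos.2 (ne_zero_of_im_pos h3).1)

theorem shapeRatio_ne_zero (z : DehnFillingSpace) : shapeRatio z ≠ 0 :=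
  (ne_zero_of_im_pos (shapeRatio_im_pos z)).1

theorem shapeRatio_mul (z : DehnFillingSpace) :
    shapeRatio z * (z.1.1 * (1 - z.1.2)) = z.1.2 :=
  div_mul_cancel₀ _ (shape_ne_zero z)

/-- Eliminating z₁ from the edge equation gives w² - (m² - m + 1)w + m² = 0; substituting w = W m
and dividing by W m² makes it symmetric. Both the traces and the local inversion of u depend on this
form. -/
theorem shapeRatio_add_inv (z : DehnFillingSpace) :
    shapeRatio z + (shapeRatio z)⁻¹ =
      z.1.1 * (1 - z.1.2) + (z.1.1 * (1 - z.1.2))⁻¹ - 1 := by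
  have h := edge_equation z
  have h0 := shape_ne_zero z
  have h1 := shapeRatio_ne_zero z
  have h2 := shapeRatio_mul z
  generalize hm : z.1.1 * (1 - z.1.2) = m at *
  generalize shapeRatio z = W at *
  have h4 : z.1.2 ^ 2 - (m ^ 2 - m + 1) * z.1.2 + m ^ 2 = 0 := by
    linear_combination (1 - z.1.2) * h - z.1.2 * hm
  rw [← h2] at h4
  field_simp
  have h5 : m ^ 2 * (W ^ 2 * m + m - W * (m ^ 2 - m + 1)) = 0 := by linear_combination m * h4
  have h6 := (mul_eq_zero.1 h5).resolve_left (pow_ne_zero 2 h0)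
  linear_combination h6

/-! ### Complexification of the Klein model -/

/-- The complex-linear extension of `herm`. -/
noncomputable def hermC : (Fin 4 → ℂ) ≃ₗ[ℂ] Matrix (Fin 2) (Fin 2) ℂ where
  toFun p := !![(p 3 - p 2) / 2, p 0 / 4 + p 1 / 4 * Complex.I;
    p 0 / 4 - p 1 / 4 * Complex.I, (p 3 + p 2) / 8]
  invFun M := ![2 * (M 0 1 + M 1 0), -2 * Complex.I * (M 0 1 - M 1 0), 4 * M 1 1 - M 0 0,
    4 * M 1 1 + M 0 0]
  map_add' p q := by
    ext i j
    fin_cases i <;> fin_cases j <;> simp <;> ring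
  map_smul' c p := by
    ext i j
    fin_cases i <;> fin_cases j <;> simp <;> ring
  left_inv p := by
    ext i
    fin_cases i <;> simp <;> ring_nf
    simp
  right_inv M := by
    ext i j
    fin_cases i <;> fin_cases j <;> simp <;> ring_nf <;> simp <;> ring

theorem hermC_ofReal (p : Fin 4 → ℝ) : hermC (fun i => (p i : ℂ)) = herm p := by
  ext i j
  fin_cases i <;> fin_cases j <;> simp [hermC, herm]

/-- Both sides are complex-linear in `p` and agree on real vectors, where `herm` conjugates the
Klein action to M ↦ g M gᴴ. -/
theorem hermC_kleinMatrix (g : Matrix (Fin 2) (Fin 2) ℂ) (p : Fin 4 → ℂ) :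
    hermC ((kleinMatrix g).map Complex.ofReal *ᵥ p) = g * hermC p * gᴴ := by
  have hh (v : Fin 4 → ℝ) : herm (kleinMatrix g *ᵥ v) = g * herm v * gᴴ := by
    change herm (LinearMap.toMatrix' (hermAction g) *ᵥ v) = _
    rw [LinearMap.toMatrix'_mulVec]
    exact herm_coords (Matrix.isHermitian_mul_mul_conjTranspose g (herm_isHermitian v))
  have hr (v : Fin 4 → ℝ) :
      hermC ((kleinMatrix g).map Complex.ofReal *ᵥ fun i => (v i : ℂ)) =
        g * hermC (fun i => (v i : ℂ)) * gᴴ := by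
    rw [hermC_ofReal, ← hh, ← hermC_ofReal]
    congr 1
    ext i
    simp [Matrix.mulVec, dotProduct]
  have hp : p = (fun i => ((p i).re : ℂ)) + Complex.I • (fun i => ((p i).im : ℂ)) := by
    ext i
    simp [mul_comm Complex.I, Complex.re_add_im]
  rw [hp, Matrix.mulVec_add, Matrix.mulVec_smul, map_add, map_smul, hr, hr, map_add, map_smul,
    Matrix.mul_add, Matrix.add_mul, Matrix.mul_smul, Matrix.smul_mul]

/-! ### Linear maps that commute with `M ↦ g M gᴴ` -/

section Sandwich

variable (f : Matrix (Fin 2) (Fin 2) ℂ →ₗ[ℂ] Matrix (Fin 2) (Fin 2) ℂ)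

/-- The matrices whose left multiplication commutes with `f`. -/
def leftCommutant : Subalgebra ℂ (Matrix (Fin 2) (Fin 2) ℂ) where
  carrier := {g | ∀ M, f (g * M) = g * f M}
  mul_mem' {g h} hg hh M := by
    rw [Matrix.mul_assoc, hg, hh, Matrix.mul_assoc]
  add_mem' {g h} hg hh M := by rw [Matrix.add_mul, map_add, hg, hh, Matrix.add_mul]
  algebraMap_mem' c M := by simp [Algebra.algebraMap_eq_smul_one]

/-- The matrices `g` such that right multiplication by `gᴴ` commutes with `f`. -/
def rightCommutant : Subalgebra ℂ (Matrix (Fin 2) (Fin 2) ℂ) where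
  carrier := {g | ∀ M, f (M * gᴴ) = f M * gᴴ}
  mul_mem' {g h} hg hh M := by
    rw [Matrix.conjTranspose_mul, ← Matrix.mul_assoc, hg, hh, Matrix.mul_assoc]
  add_mem' {g h} hg hh M := by
    rw [Matrix.conjTranspose_add, Matrix.mul_add, map_add, hg, hh, Matrix.mul_add]
  algebraMap_mem' c M := by simp [Algebra.algebraMap_eq_smul_one]

variable {f}

theorem mul_self_eq_of_det_eq_one {g : Matrix (Fin 2) (Fin 2) ℂ} (hg : g.det = 1) :
    g * g = g.trace • g - 1 := by
  rw [Matrix.det_fin_two] at hg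
  ext i j
  fin_cases i <;> fin_cases j <;>
    simp [Matrix.trace_fin_two, Matrix.mul_apply, Fin.sum_univ_two]
  · linear_combination -hg
  · ring
  · ring
  · linear_combination -hg

/-- Let S be M ↦ g M gᴴ and t = tr g. By Cayley–Hamilton g⁻¹ = t - g, and |t|²S - S² + 1 = tL + t̄R,
S - S⁻¹ + |t|² = t̄L + tR for left multiplication L by g and right multiplication R by gᴴ.
Eliminating R expresses (t² - t̄²)L through powers of S. -/
theorem smul_mul_eq_sandwich {g : Matrix (Fin 2) (Fin 2) ℂ} (hg : g.det = 1)
    (M : Matrix (Fin 2) (Fin 2) ℂ) :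
    (g.trace ^ 2 - star g.trace ^ 2) • (g * M) =
      g.trace • ((g.trace * star g.trace) • (g * M * gᴴ) - g * (g * M * gᴴ) * gᴴ + M) -
      star g.trace • (g * M * gᴴ - (g.trace • 1 - g) * M * (g.trace • 1 - g)ᴴ +
        (g.trace * star g.trace) • M) := by
  have h1 := mul_self_eq_of_det_eq_one hg
  have h2 : gᴴ * gᴴ = star g.trace • gᴴ - 1 := by
    rw [← Matrix.conjTranspose_mul, h1]; simp
  have h3 : g * (g * M * gᴴ) * gᴴ = (g * g) * M * (gᴴ * gᴴ) := by simp only [Matrix.mul_assoc]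
  rw [h3, h1, h2]
  simp only [Matrix.sub_mul, Matrix.mul_sub, Matrix.smul_mul, Matrix.mul_smul, Matrix.one_mul,
    Matrix.mul_one, Matrix.conjTranspose_sub, Matrix.conjTranspose_smul, Matrix.conjTranspose_one]
  module

/-- Commuting with S entails commuting with S⁻¹, hence with left multiplication by g once t² ≠ t̄².
Cancelling g from the sandwich relation leaves right multiplication by gᴴ. -/
theorem mem_commutants_of_sandwich {g : Matrix (Fin 2) (Fin 2) ℂ} (hg : g.det = 1)
    (ht : (g.trace ^ 2).im ≠ 0) (hf : ∀ M, f (g * M * gᴴ) = g * f M * gᴴ) :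
    g ∈ leftCommutant f ∧ g ∈ rightCommutant f := by
  have h1 := mul_self_eq_of_det_eq_one hg
  have hk : (g.trace • 1 - g) * g = 1 := by
    rw [Matrix.sub_mul, h1]; simp
  have hk' : g * (g.trace • 1 - g) = 1 := by
    rw [Matrix.mul_sub, h1]; simp
  have hf' (M) : f ((g.trace • 1 - g) * M * (g.trace • 1 - g)ᴴ) =
      (g.trace • 1 - g) * f M * (g.trace • 1 - g)ᴴ := by
    generalize g.trace • (1 : Matrix (Fin 2) (Fin 2) ℂ) - g = k at *
    have hkt : gᴴ * kᴴ = 1 := by rw [← Matrix.conjTranspose_mul, hk]; simp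
    have hkt' : kᴴ * gᴴ = 1 := by rw [← Matrix.conjTranspose_mul, hk']; simp
    have e : g * (k * M * kᴴ) * gᴴ = M := by
      rw [← Matrix.mul_assoc, ← Matrix.mul_assoc, hk', Matrix.one_mul, Matrix.mul_assoc, hkt',
        Matrix.mul_one]
    have e2 := hf (k * M * kᴴ)
    rw [e] at e2
    rw [e2]
    generalize f (k * M * kᴴ) = B
    rw [← Matrix.mul_assoc, ← Matrix.mul_assoc, hk, Matrix.one_mul, Matrix.mul_assoc, hkt,
      Matrix.mul_one]
  have ht' : g.trace ^ 2 - star g.trace ^ 2 ≠ 0 := by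
    intro h0
    rw [← star_pow, sub_eq_zero] at h0
    exact ht (Complex.conj_eq_iff_im.1 h0.symm)
  have hl (M) : f (g * M) = g * f M := by
    apply smul_right_injective _ ht'
    simp only
    rw [← map_smul, smul_mul_eq_sandwich hg, smul_mul_eq_sandwich hg]
    simp only [map_sub, map_add, map_smul, hf, hf']
  refine ⟨hl, fun M => ?_⟩
  have e := hf M
  rw [Matrix.mul_assoc, hl] at e
  have e2 := congrArg ((g.trace • 1 - g) * ·) e
  simpa only [← Matrix.mul_assoc, hk, Matrix.one_mul] using e2

/-- Here f(M) = M f(1) = f(1) M, so f(1) is central in M₂(ℂ); commuting with the off-diagonal matrix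
units forces it to be scalar. -/
theorem eq_smul_of_commutants_eq_top (hl : leftCommutant f = ⊤) (hr : rightCommutant f = ⊤) :
    ∃ c : ℂ, ∀ M, f M = c • M := by
  have h1 (M) : f M = M * f 1 := by
    have : M ∈ leftCommutant f := hl ▸ Algebra.mem_top
    simpa using this 1
  have h2 (M) : f M = f 1 * M := by
    have : Mᴴ ∈ rightCommutant f := hr ▸ Algebra.mem_top
    simpa using this 1
  have h3 (M) : M * f 1 = f 1 * M := (h1 M).symm.trans (h2 M)
  refine ⟨f 1 0 0, fun M => ?_⟩
  have e1 := h3 (Matrix.single 0 1 1)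
  have e2 := h3 (Matrix.single 1 0 1)
  rw [h1]
  generalize f 1 = C at *
  have a1 := congrFun (congrFun e1 0) 0
  have a2 := congrFun (congrFun e1 0) 1
  have a3 := congrFun (congrFun e2 0) 0
  simp [Matrix.mul_apply, Matrix.single_apply] at a1 a2 a3
  have : C = C 0 0 • 1 := by
    ext i j
    fin_cases i <;> fin_cases j <;> simp [a1, a2, ← a3]
  rw [this]
  simp

end Sandwich

/-- A subalgebra of `M₂(ℂ)` that contains `[α, β; γ, δ]` with `β, γ ≠ 0` and a non-scalar diagonal
matrix is everything. -/
theorem subalgebra_eq_top_of_diagonal {S : Subalgebra ℂ (Matrix (Fin 2) (Fin 2) ℂ)}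
    {g : Matrix (Fin 2) (Fin 2) ℂ} (hg : g ∈ S) (h01 : g 0 1 ≠ 0) (h10 : g 1 0 ≠ 0) {d e : ℂ}
    (hde : d - e ≠ 0) (hd : !![d, 0; 0, e] ∈ S) : S = ⊤ := by
  -- Removing a scalar from the diagonal matrix and rescaling gives an idempotent; the corners of
  -- `g` cut out by it and its complement give the off-diagonal units.
  have h1 : !![1, 0; 0, 0] ∈ S := by
    have : (d - e)⁻¹ • (!![d, 0; 0, e] - algebraMap ℂ _ e) ∈ S :=
      S.smul_mem (S.sub_mem hd (S.algebraMap_mem e)) _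
    convert this using 1
    ext i j
    fin_cases i <;> fin_cases j <;> simp [Algebra.algebraMap_eq_smul_one, hde]
  have h2 : !![0, 0; 0, 1] ∈ S := by
    convert S.sub_mem S.one_mem h1 using 1
    ext i j
    fin_cases i <;> fin_cases j <;> simp
  have h3 : !![0, 1; 0, 0] ∈ S := by
    convert S.smul_mem (S.mul_mem (S.mul_mem h1 hg) h2) (g 0 1)⁻¹ using 1
    ext i j
    simp only [Matrix.smul_apply, Matrix.mul_apply, Fin.sum_univ_two]
    fin_cases i <;> fin_cases j <;> simp [h01]
  have h4 : !![0, 0; 1, 0] ∈ S := by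
    convert S.smul_mem (S.mul_mem (S.mul_mem h2 hg) h1) (g 1 0)⁻¹ using 1
    ext i j
    simp only [Matrix.smul_apply, Matrix.mul_apply, Fin.sum_univ_two]
    fin_cases i <;> fin_cases j <;> simp [h10]
  refine Algebra.eq_top_iff.2 fun M => ?_
  convert S.add_mem (S.add_mem (S.smul_mem h1 (M 0 0)) (S.smul_mem h3 (M 0 1)))
    (S.add_mem (S.smul_mem h4 (M 1 0)) (S.smul_mem h2 (M 1 1))) using 1
  ext i j
  fin_cases i <;> fin_cases j <;> simp

/-! ### The fibre group has no invariants in `𝔳` -/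

theorem slHol_x (z : DehnFillingSpace) : slHol z KnotGroup.x = slX z := by
  simp [slHol, KnotGroup.x]

theorem slHol_y (z : DehnFillingSpace) : slHol z KnotGroup.y = slY z := by
  simp [slHol, KnotGroup.y]

theorem slHol_b (z : DehnFillingSpace) :
    (slHol z KnotGroup.b : Matrix (Fin 2) (Fin 2) ℂ) =
      !![(1 - z.1.2) * (z.1.1 * (1 - z.1.2))⁻¹, -1; z.1.2, z.1.1 * (1 - z.1.2)] := by
  have hs := sqrtHol_ne_zero z
  rw [KnotGroup.b, map_mul, map_inv, slHol_x, slHol_y, Matrix.SpecialLinearGroup.coe_mul,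
    Matrix.SpecialLinearGroup.coe_inv]
  simp only [slX, slY, Matrix.adjugate_fin_two_of, Matrix.mul_fin_two, ← sqrtHol_sq z]
  ext i j
  fin_cases i <;> fin_cases j <;> simp <;> field_simp
  ring

theorem slHol_inv_b_mul_a (z : DehnFillingSpace) :
    (slHol z (KnotGroup.b⁻¹ * KnotGroup.a) : Matrix (Fin 2) (Fin 2) ℂ) =
      !![z.1.1 * (1 - z.1.2) - z.1.2 * (z.1.1 * (1 - z.1.2))⁻¹, (z.1.1 * (1 - z.1.2))⁻¹;
        -z.1.2 * (z.1.1 * (1 - z.1.2))⁻¹, (z.1.1 * (1 - z.1.2))⁻¹] := by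
  have hs := sqrtHol_ne_zero z
  have h : KnotGroup.b⁻¹ * KnotGroup.a = KnotGroup.x⁻¹ * KnotGroup.y := by
    simp [KnotGroup.a, KnotGroup.b, mul_assoc]
  rw [h, map_mul, map_inv, slHol_x, slHol_y, Matrix.SpecialLinearGroup.coe_mul,
    Matrix.SpecialLinearGroup.coe_inv]
  simp only [slX, slY, Matrix.adjugate_fin_two_of, Matrix.mul_fin_two, ← sqrtHol_sq z]
  ext i j
  fin_cases i <;> fin_cases j <;> simp <;> field_simp
  ring

theorem trace_slHol_b (z : DehnFillingSpace) :
    (slHol z KnotGroup.b : Matrix (Fin 2) (Fin 2) ℂ).trace = 1 + (shapeRatio z)⁻¹ := by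
  have h := shapeRatio_add_inv z
  have h0 := shape_ne_zero z
  have h1 := shapeRatio_mul z
  rw [slHol_b, Matrix.trace_fin_two_of]
  generalize z.1.1 * (1 - z.1.2) = m at *
  rw [← h1]
  have : (1 - shapeRatio z * m) * m⁻¹ = m⁻¹ - shapeRatio z := by field_simp
  rw [this]
  linear_combination -h

theorem trace_slHol_inv_b_mul_a (z : DehnFillingSpace) :
    (slHol z (KnotGroup.b⁻¹ * KnotGroup.a) : Matrix (Fin 2) (Fin 2) ℂ).trace =
      1 + (shapeRatio z)⁻¹ := by
  have h := shapeRatio_add_inv z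
  have h0 := shape_ne_zero z
  have h1 := shapeRatio_mul z
  rw [slHol_inv_b_mul_a, Matrix.trace_fin_two_of]
  generalize z.1.1 * (1 - z.1.2) = m at *
  rw [← h1, mul_assoc, mul_inv_cancel₀ h0]
  linear_combination -h

theorem trace_slHol_a (z : DehnFillingSpace) :
    (slHol z KnotGroup.a : Matrix (Fin 2) (Fin 2) ℂ).trace = 1 + shapeRatio z := by
  have h := shapeRatio_add_inv z
  have h0 := shape_ne_zero z
  have hW := shapeRatio_ne_zero z
  have h1 := shapeRatio_mul z
  have e : KnotGroup.a = KnotGroup.b * (KnotGroup.b⁻¹ * KnotGroup.a) := by group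
  rw [e, map_mul, Matrix.SpecialLinearGroup.coe_mul, slHol_b, slHol_inv_b_mul_a,
    Matrix.mul_fin_two, Matrix.trace_fin_two_of]
  generalize z.1.1 * (1 - z.1.2) = m at *
  rw [← h1]
  generalize shapeRatio z = W at *
  field_simp at h ⊢
  linear_combination h

/-- Since ba = x a x⁻¹, the generating pair a, ba has a common trace, just as the pair b, b⁻¹a does;
a condition on one trace thus serves a whole generating pair. -/
theorem trace_slHol_b_mul_a (z : DehnFillingSpace) :
    (slHol z (KnotGroup.b * KnotGroup.a) : Matrix (Fin 2) (Fin 2) ℂ).trace =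
      1 + shapeRatio z := by
  rw [← trace_slHol_a, ← KnotGroup.conj_a, map_mul, map_mul, map_inv,
    Matrix.SpecialLinearGroup.coe_mul, Matrix.trace_mul_comm, ← Matrix.SpecialLinearGroup.coe_mul,
    inv_mul_cancel_left]

/-- If both squares were real, Im W > 0 would force Re W = -1 and Re W = -|W|², hence |W| = 1 and Im
W = 0. -/
theorem sq_im_ne_zero (z : DehnFillingSpace) :
    ((1 + shapeRatio z) ^ 2).im ≠ 0 ∨ ((1 + (shapeRatio z)⁻¹) ^ 2).im ≠ 0 := by
  have h := shapeRatio_im_pos z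
  have hn := Complex.normSq_pos.2 (shapeRatio_ne_zero z)
  generalize shapeRatio z = W at *
  by_contra! hc
  obtain ⟨h1, h2⟩ := hc
  simp only [pow_two, Complex.mul_im, Complex.add_re, Complex.add_im, Complex.one_re, Complex.one_im,
    Complex.inv_re, Complex.inv_im] at h1 h2
  have e1 : W.re = -1 := by
    have : W.im * (1 + W.re) = 0 := by linarith
    have := (mul_eq_zero.1 this).resolve_left h.ne'
    linarith
  have e2 : W.re = -Complex.normSq W := by
    field_simp at h2
    have : W.im * (Complex.normSq W + W.re) = 0 := by linarith
    have := (mul_eq_zero.1 this).resolve_left h.ne'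
    linarith
  rw [Complex.normSq_apply, e1] at e2
  nlinarith

/-- At m = -1 the ratio would solve W² + 3W + 1 = 0, whose roots are real. -/
theorem meridian_add_one_ne_zero (z : DehnFillingSpace) : z.1.1 * (1 - z.1.2) + 1 ≠ 0 := by
  intro h0
  have hm : z.1.1 * (1 - z.1.2) = -1 := by linear_combination h0
  have h := shapeRatio_add_inv z
  have hi := shapeRatio_im_pos z
  have hW := shapeRatio_ne_zero z
  rw [hm] at h
  generalize shapeRatio z = W at *
  have e : W ^ 2 + 3 * W + 1 = 0 := by
    field_simp at h
    linear_combination h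
  have er := congrArg Complex.re e
  have ei := congrArg Complex.im e
  simp [pow_two] at er ei
  have : W.im * (2 * W.re + 3) = 0 := by linarith
  have := (mul_eq_zero.1 this).resolve_left hi.ne'
  nlinarith [mul_pos hi hi]

/-- In b + m·(b⁻¹a) the off-diagonal entries cancel, and the diagonal entries differ by (m + 1)(1/W
- 1), which is nonzero because m ≠ -1 and W is not real. -/
theorem subalgebra_eq_top_of_slHol_mem (z : DehnFillingSpace)
    {S : Subalgebra ℂ (Matrix (Fin 2) (Fin 2) ℂ)} (hb : (slHol z KnotGroup.b).1 ∈ S)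
    (hc : (slHol z (KnotGroup.b⁻¹ * KnotGroup.a)).1 ∈ S) : S = ⊤ := by
  have h := shapeRatio_add_inv z
  have h0 := shape_ne_zero z
  have h1 := shapeRatio_mul z
  have hW := shapeRatio_ne_zero z
  have hi := shapeRatio_im_pos z
  have hm := meridian_add_one_ne_zero z
  have hw := (ne_zero_of_im_pos z.2.2.1).1
  have hd := S.add_mem hb (S.smul_mem hc (z.1.1 * (1 - z.1.2)))
  rw [slHol_inv_b_mul_a, slHol_b] at hd
  rw [slHol_b] at hb
  generalize z.1.1 * (1 - z.1.2) = m at *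
  generalize z.1.2 = w at *
  refine subalgebra_eq_top_of_diagonal hb (by simp) (by simpa using hw)
    (d := (1 - w) * m⁻¹ + m ^ 2 - w) (e := m + 1) ?_ ?_
  · rw [← h1]
    generalize shapeRatio z = W at *
    have e : (1 - W * m) * m⁻¹ + m ^ 2 - W * m - (m + 1) = (m + 1) * (W⁻¹ - 1) := by
      have hmul : (1 - W * m) * m⁻¹ = m⁻¹ - W := by field_simp
      rw [hmul]
      have h2 : m * W⁻¹ = m ^ 2 + 1 - m - m * W := by
        have := congrArg (m * ·) h
        simp only [mul_sub, mul_add, mul_inv_cancel₀ h0] at this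
        linear_combination this
      linear_combination -h2 - h
    rw [e]
    refine mul_ne_zero hm fun h2 => ?_
    have : W = 1 := by rw [← inv_inv W, sub_eq_zero.1 h2, inv_one]
    simp [this] at hi
  · convert hd using 1
    ext i j
    fin_cases i <;> fin_cases j <;> simp <;> field_simp <;> ring

theorem a_mem_fiber : KnotGroup.a ∈ KnotGroup.fiber := Subgroup.subset_closure (by simp)

theorem b_mem_fiber : KnotGroup.b ∈ KnotGroup.fiber := Subgroup.subset_closure (by simp)

/-- A trace-free matrix that commutes with the holonomy of the fibre group vanishes. -/
theorem eq_zero_of_commute_hol_fiber (z : DehnFillingSpace) {A : Matrix (Fin 4) (Fin 4) ℝ}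
    (h0 : A.trace = 0)
    (hA : ∀ γ ∈ KnotGroup.fiber, (hol z γ : Matrix (Fin 4) (Fin 4) ℝ) * A = A * hol z γ) :
    A = 0 := by
  -- The complexification of `A`, carried to M₂(ℂ), where the holonomy acts by M ↦ g M gᴴ.
  let f : Matrix (Fin 2) (Fin 2) ℂ →ₗ[ℂ] Matrix (Fin 2) (Fin 2) ℂ :=
    hermC.toLinearMap ∘ₗ (Matrix.mulVecLin (A.map Complex.ofReal)) ∘ₗ hermC.symm.toLinearMap
  have hf : ∀ γ ∈ KnotGroup.fiber, ∀ M, f ((slHol z γ).1 * M * (slHol z γ).1ᴴ) =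
      (slHol z γ).1 * f M * (slHol z γ).1ᴴ := by
    intro γ hγ M
    obtain ⟨p, rfl⟩ := hermC.surjective M
    have h1 : (kleinMatrix (slHol z γ).1).map Complex.ofReal * A.map Complex.ofReal =
        A.map Complex.ofReal * (kleinMatrix (slHol z γ).1).map Complex.ofReal := by
      have := congrArg (fun B => B.map Complex.ofRealHom) (hA γ hγ)
      rwa [Matrix.map_mul, Matrix.map_mul] at this
    simp only [f, ← hermC_kleinMatrix, LinearMap.comp_apply, LinearEquiv.coe_coe,
      LinearEquiv.symm_apply_apply, Matrix.mulVecLin_apply, Matrix.mulVec_mulVec, h1]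
  have hcomm : ∀ γ ∈ KnotGroup.fiber, ((slHol z γ).1.trace ^ 2).im ≠ 0 →
      (slHol z γ).1 ∈ leftCommutant f ∧ (slHol z γ).1 ∈ rightCommutant f := fun γ hγ ht =>
    mem_commutants_of_sandwich (slHol z γ).2 ht (hf γ hγ)
  have ha := a_mem_fiber
  have hb := b_mem_fiber
  have key : ((slHol z KnotGroup.b).1 ∈ leftCommutant f ∧
      (slHol z (KnotGroup.b⁻¹ * KnotGroup.a)).1 ∈ leftCommutant f) ∧
      ((slHol z KnotGroup.b).1 ∈ rightCommutant f ∧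
      (slHol z (KnotGroup.b⁻¹ * KnotGroup.a)).1 ∈ rightCommutant f) := by
    -- Whichever trace has a non-real square decides the generating pair: a, ba in the first case,
    -- b, b⁻¹a in the second. Inverses stay in the subalgebra because g⁻¹ = tr g - g.
    rcases sq_im_ne_zero z with ht | ht
    · have h1 := hcomm _ ha (by rwa [trace_slHol_a])
      have h2 := hcomm _ (mul_mem hb ha) (by rwa [trace_slHol_b_mul_a])
      have inv_mem : ∀ {S : Subalgebra ℂ (Matrix (Fin 2) (Fin 2) ℂ)} {γ : KnotGroup},
          (slHol z γ).1 ∈ S → (slHol z γ⁻¹).1 ∈ S := by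
        intro S γ hγ
        have e : (slHol z γ⁻¹).1 = algebraMap ℂ _ (slHol z γ).1.trace - (slHol z γ).1 := by
          rw [map_inv, Matrix.SpecialLinearGroup.coe_inv, Matrix.adjugate_fin_two]
          ext i j
          fin_cases i <;> fin_cases j <;>
            simp [Algebra.algebraMap_eq_smul_one, Matrix.trace_fin_two]
        rw [e]
        exact S.sub_mem (S.algebraMap_mem _) hγ
      have gen : ∀ {S : Subalgebra ℂ (Matrix (Fin 2) (Fin 2) ℂ)},
          (slHol z KnotGroup.a).1 ∈ S → (slHol z (KnotGroup.b * KnotGroup.a)).1 ∈ S →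
          (slHol z KnotGroup.b).1 ∈ S ∧ (slHol z (KnotGroup.b⁻¹ * KnotGroup.a)).1 ∈ S := by
        intro S h1 h2
        have h3 : (slHol z KnotGroup.b).1 ∈ S := by
          have := S.mul_mem h2 (inv_mem h1)
          rwa [← Matrix.SpecialLinearGroup.coe_mul, ← map_mul, mul_inv_cancel_right] at this
        refine ⟨h3, ?_⟩
        rw [map_mul, Matrix.SpecialLinearGroup.coe_mul]
        exact S.mul_mem (inv_mem h3) h1
      exact ⟨gen h1.1 h2.1, gen h1.2 h2.2⟩
    · have h1 := hcomm _ hb (by rwa [trace_slHol_b])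
      have h2 := hcomm _ (mul_mem (inv_mem hb) ha) (by rwa [trace_slHol_inv_b_mul_a])
      exact ⟨⟨h1.1, h2.1⟩, ⟨h1.2, h2.2⟩⟩
  obtain ⟨c, hc⟩ := eq_smul_of_commutants_eq_top
    (subalgebra_eq_top_of_slHol_mem z key.1.1 key.1.2)
    (subalgebra_eq_top_of_slHol_mem z key.2.1 key.2.2)
  have hAc (i j) : (A i j : ℂ) = if i = j then c else 0 := by
    have h1 := hc (hermC (Pi.single j 1))
    rw [← map_smul] at h1
    simp only [f, LinearMap.comp_apply, LinearEquiv.coe_coe, LinearEquiv.symm_apply_apply,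
      Matrix.mulVecLin_apply] at h1
    have h2 := congrFun (hermC.injective h1) i
    simpa [Pi.single_apply] using h2
  have hc0 : c = 0 := by
    have h1 := congrArg Complex.ofReal h0
    simp [Matrix.trace, Fin.sum_univ_four, hAc] at h1
    linear_combination h1 / 4
  ext i j
  have := hAc i j
  simpa [hc0] using this

theorem eq_zero_of_adRep_fiber_eq (z : DehnFillingSpace) {A : vModule}
    (hA : ∀ γ ∈ KnotGroup.fiber, adRep z γ A = A) : A = 0 := by
  refine Subtype.ext (eq_zero_of_commute_hol_fiber z (mem_vModule.1 A.2).1 fun γ hγ => ?_)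
  have h := congrArg (fun B : vModule => B.1 * (hol z γ : Matrix (Fin 4) (Fin 4) ℝ)) (hA γ hγ)
  have e1 : ((hol z γ)⁻¹ : GL (Fin 4) ℝ).1 * (hol z γ).1 = 1 := (hol z γ).inv_mul
  change (hol z γ).1 * A.1 * ((hol z γ)⁻¹ : GL (Fin 4) ℝ).1 * (hol z γ).1 = A.1 * (hol z γ).1 at h
  rwa [Matrix.mul_assoc, e1, Matrix.mul_one] at h

/-! ### Homomorphisms from the knot group, and freeness of the fibre group -/

/-- The knot group is the extension of the group generated by `a` and `b` by conjugation with `x`: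
a homomorphism may be prescribed on `x`, `a`, `b`. -/
theorem exists_hom_of_conj {K : Type*} [Group K] {X A B : K} (h1 : X * A = B * A * X)
    (h2 : X * B = B * A * B * X) :
    ∃ Θ : KnotGroup →* K, Θ KnotGroup.x = X ∧ Θ KnotGroup.a = A ∧ Θ KnotGroup.b = B := by
  -- With Y = B⁻¹X playing the role of y, the word defining a must evaluate to A; the two relations
  -- give X A⁻¹ B X⁻¹ = B, from which this follows.
  have hA : X * (B⁻¹ * X)⁻¹ * X⁻¹ * (B⁻¹ * X) = A := by
    have h3 : X * A⁻¹ * B = B * X := by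
      calc X * A⁻¹ * B = (X * A * X⁻¹)⁻¹ * (X * B * X⁻¹) * X := by group
        _ = B * X := by rw [h1, h2]; group
    have h4 : B * X⁻¹ * B⁻¹ * X = A := by
      calc B * X⁻¹ * B⁻¹ * X = B * (B * X)⁻¹ * X := by group
        _ = A := by rw [← h3]; group
    rw [← h4]; group
  have hrel : ∀ r ∈ knotRelators, FreeGroup.lift ![X, B⁻¹ * X] r = 1 := by
    rintro r rfl
    simp only [map_mul, map_inv, FreeGroup.lift_apply_of]
    refine mul_inv_eq_one.2 ?_
    change X * (B⁻¹ * X)⁻¹ * X⁻¹ * (B⁻¹ * X) * X =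
      B⁻¹ * X * (X * (B⁻¹ * X)⁻¹ * X⁻¹ * (B⁻¹ * X))
    rw [hA, mul_assoc B⁻¹, h1]
    group
  have hx : PresentedGroup.toGroup hrel KnotGroup.x = X := by simp [KnotGroup.x]
  have hy : PresentedGroup.toGroup hrel KnotGroup.y = B⁻¹ * X := by simp [KnotGroup.y]
  refine ⟨PresentedGroup.toGroup hrel, hx, ?_, ?_⟩
  · simp only [KnotGroup.a, map_mul, map_inv, hx, hy, hA]
  · simp [KnotGroup.b, hx, hy]

theorem x_mul_a : KnotGroup.x * KnotGroup.a = KnotGroup.b * KnotGroup.a * KnotGroup.x :=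
  mul_inv_eq_iff_eq_mul.1 KnotGroup.conj_a

theorem x_mul_b :
    KnotGroup.x * KnotGroup.b = KnotGroup.b * KnotGroup.a * KnotGroup.b * KnotGroup.x :=
  mul_inv_eq_iff_eq_mul.1 KnotGroup.conj_b

theorem hom_eq_of_x_b {K : Type*} [Group K] {Θ Θ' : KnotGroup →* K}
    (hx : Θ KnotGroup.x = Θ' KnotGroup.x) (hb : Θ KnotGroup.b = Θ' KnotGroup.b) : Θ = Θ' := by
  refine PresentedGroup.ext fun i => ?_
  fin_cases i
  · exact hx
  · change Θ KnotGroup.y = Θ' KnotGroup.y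
    rw [KnotGroup.y_eq, map_mul, map_mul, map_inv, map_inv, hx, hb]

/-- The monodromy `a ↦ b a`, `b ↦ b a b` of the free group on `a` and `b`. -/
def freeMonodromy : MulAut (FreeGroup (Fin 2)) :=
  MonoidHom.toMulEquiv
    (FreeGroup.lift ![FreeGroup.of 1 * FreeGroup.of 0,
      FreeGroup.of 1 * FreeGroup.of 0 * FreeGroup.of 1])
    (FreeGroup.lift ![(FreeGroup.of 1)⁻¹ * FreeGroup.of 0 * FreeGroup.of 0,
      (FreeGroup.of 0)⁻¹ * FreeGroup.of 1])
    (by ext i; fin_cases i <;> simp [mul_assoc])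
    (by ext i; fin_cases i <;> simp [mul_assoc])

/-- The retraction of the fibre group onto the free group. -/
theorem exists_fiber_hom_freeGroup : ∃ π : KnotGroup.fiber →* FreeGroup (Fin 2),
    π ⟨KnotGroup.a, a_mem_fiber⟩ = FreeGroup.of 0 ∧
    π ⟨KnotGroup.b, b_mem_fiber⟩ = FreeGroup.of 1 := by
  -- The mapping torus group F₂ ⋊ ℤ, whose stable letter is the image of x.
  let φ := zpowersHom (MulAut (FreeGroup (Fin 2))) freeMonodromy
  have hconj (g : FreeGroup (Fin 2)) :
      (SemidirectProduct.inr (Multiplicative.ofAdd 1) : FreeGroup (Fin 2) ⋊[φ] Multiplicative ℤ) *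
        SemidirectProduct.inl g =
      SemidirectProduct.inl (freeMonodromy g) * SemidirectProduct.inr (Multiplicative.ofAdd 1) := by
    have := SemidirectProduct.inl_aut (φ := φ) (Multiplicative.ofAdd 1) g
    have e : φ (Multiplicative.ofAdd 1) = freeMonodromy := by simp [φ]
    rw [e] at this
    rw [this, map_inv, inv_mul_cancel_right]
  obtain ⟨Ψ, -, ha, hb⟩ := exists_hom_of_conj
    (X := (SemidirectProduct.inr (Multiplicative.ofAdd 1) :
      FreeGroup (Fin 2) ⋊[φ] Multiplicative ℤ))
    (A := SemidirectProduct.inl (FreeGroup.of 0)) (B := SemidirectProduct.inl (FreeGroup.of 1))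
    (by rw [hconj, ← map_mul]; simp [freeMonodromy])
    (by rw [hconj, ← map_mul, ← map_mul]; simp [freeMonodromy])
  -- The fibre group lands in the kernel of the projection to ℤ, where taking the F₂-component is
  -- multiplicative.
  have hright : KnotGroup.fiber ≤ (SemidirectProduct.rightHom.comp Ψ).ker := by
    refine (Subgroup.closure_le _).2 ?_
    rintro h (rfl | rfl)
    · simp [MonoidHom.mem_ker, ha]
    · simp [MonoidHom.mem_ker, hb]
  have hright' (h : KnotGroup.fiber) : (Ψ h).right = 1 := hright h.2
  refine ⟨{ toFun := fun h => (Ψ h).left, map_one' := by simp, map_mul' := fun g h => ?_ }, ?_, ?_⟩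
  · simp [hright']
  · simp [ha]
  · simp [hb]

theorem fiber_induction {p : KnotGroup.fiber → Prop} (ha : p ⟨KnotGroup.a, a_mem_fiber⟩)
    (hb : p ⟨KnotGroup.b, b_mem_fiber⟩) (h1 : p 1) (hmul : ∀ g h, p g → p h → p (g * h))
    (hinv : ∀ g, p g → p g⁻¹) (h : KnotGroup.fiber) : p h := by
  obtain ⟨h, hh⟩ := h
  induction hh using Subgroup.closure_induction with
  | mem g hg =>
    rcases hg with rfl | rfl
    · exact ha
    · exact hb
  | one => exact h1
  | mul g k hg hk ig ik => exact hmul ⟨g, hg⟩ ⟨k, hk⟩ ig ik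
  | inv g hg ig => exact hinv ⟨g, hg⟩ ig

theorem knotGroup_induction {p : KnotGroup → Prop} (hx : p KnotGroup.x) (hb : p KnotGroup.b)
    (h1 : p 1) (hmul : ∀ g h, p g → p h → p (g * h)) (hinv : ∀ g, p g → p g⁻¹) (g : KnotGroup) :
    p g := by
  have hg : g ∈ Subgroup.closure (Set.range (PresentedGroup.of (rels := knotRelators))) := by
    rw [PresentedGroup.closure_range_of]; trivial
  induction hg using Subgroup.closure_induction with
  | mem g hg =>
    obtain ⟨i, rfl⟩ := hg
    fin_cases i
    · exact hx
    · change p KnotGroup.y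
      rw [KnotGroup.y_eq]
      exact hmul _ _ (hinv _ hb) hx
  | one => exact h1
  | mul g k _ _ ig ik => exact hmul g k ig ik
  | inv g _ ig => exact hinv g ig

/-! ### Crossed homomorphisms -/

section Cocycles

variable {G V : Type*} [Group G] [AddCommGroup V] [Module ℝ V]

/-- A representation as an action on the multiplicative copy of the additive group. -/
def mulAction (ρ : Representation ℝ G V) : G →* MulAut (Multiplicative V) where
  toFun g :=
    { toFun := fun v => Multiplicative.ofAdd (ρ g v.toAdd)
      invFun := fun v => Multiplicative.ofAdd (ρ g⁻¹ v.toAdd)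
      left_inv := fun v => by simp
      right_inv := fun v => by simp
      map_mul' := fun v w => by simp }
  map_one' := by ext; simp
  map_mul' g h := by ext; simp

/-- The affine transformation with linear part `g` and translation part `v`. -/
def affine (ρ : Representation ℝ G V) (v : V) (g : G) : Multiplicative V ⋊[mulAction ρ] G :=
  ⟨Multiplicative.ofAdd v, g⟩

theorem affine_mul (ρ : Representation ℝ G V) (v w : V) (g h : G) :
    affine ρ v g * affine ρ w h = affine ρ (ρ g w + v) (g * h) := by
  ext
  · exact congrArg Multiplicative.ofAdd (add_comm v (ρ g w))
  · simp [affine]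

theorem affine_injective (ρ : Representation ℝ G V) {v w : V} {g h : G} :
    affine ρ v g = affine ρ w h ↔ v = w ∧ g = h := by
  simp [affine, SemidirectProduct.ext_iff]

/-- Crossed homomorphisms are the translation parts of homomorphisms into the affine group V ⋊ G
with prescribed linear part, so they can be built from generators and relations. -/
theorem exists_cocycle_of_hom {H : Type*} [Group H] (ρ : Representation ℝ G V) (i : H →* G)
    (Θ : H →* Multiplicative V ⋊[mulAction ρ] G) (hΘ : SemidirectProduct.rightHom.comp Θ = i) :
    ∃ f : H → V, (∀ g h, f (g * h) = ρ (i g) (f h) + f g) ∧ ∀ g, Θ g = affine ρ (f g) (i g) := by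
  have hr (g) : (Θ g).right = i g := DFunLike.congr_fun hΘ g
  refine ⟨fun g => (Θ g).left.toAdd, fun g h => ?_, fun g => ?_⟩
  · beta_reduce
    rw [map_mul]
    change (Θ g).left.toAdd + ρ (Θ g).right (Θ h).left.toAdd = _
    rw [hr, add_comm]
  · ext
    · simp [affine]
    · simp [affine, hr]

theorem cocycle_one {ρ : Representation ℝ G V} {f : G → V}
    (hf : ∀ g h, f (g * h) = ρ g (f h) + f g) : f 1 = 0 := by
  simpa using hf 1 1

theorem cocycle_inv {ρ : Representation ℝ G V} {f : G → V}
    (hf : ∀ g h, f (g * h) = ρ g (f h) + f g) (g : G) : f g⁻¹ = -ρ g⁻¹ (f g) := by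
  have h := hf g⁻¹ g
  rw [inv_mul_cancel, cocycle_one hf] at h
  exact (neg_eq_of_add_eq_zero_right h.symm).symm

end Cocycles

section KnotCocycles

variable {V : Type*} [AddCommGroup V] [Module ℝ V]

/-- Crossed homomorphisms on the free fibre group may be prescribed on the generators. -/
theorem exists_fiber_cocycle (ρ : Representation ℝ KnotGroup V) (v w : V) :
    ∃ f : KnotGroup.fiber → V, (∀ g h : KnotGroup.fiber, f (g * h) = ρ g (f h) + f g) ∧
      f ⟨KnotGroup.a, a_mem_fiber⟩ = v ∧ f ⟨KnotGroup.b, b_mem_fiber⟩ = w := by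
  obtain ⟨π, ha, hb⟩ := exists_fiber_hom_freeGroup
  let Θ : KnotGroup.fiber →* Multiplicative V ⋊[mulAction ρ] KnotGroup :=
    (FreeGroup.lift ![affine ρ v KnotGroup.a, affine ρ w KnotGroup.b]).comp π
  have hΘa : Θ ⟨KnotGroup.a, a_mem_fiber⟩ = affine ρ v KnotGroup.a := by simp [Θ, ha]
  have hΘb : Θ ⟨KnotGroup.b, b_mem_fiber⟩ = affine ρ w KnotGroup.b := by simp [Θ, hb]
  have hΘ : SemidirectProduct.rightHom.comp Θ = KnotGroup.fiber.subtype := by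
    refine MonoidHom.ext fun h => ?_
    refine fiber_induction (p := fun h => SemidirectProduct.rightHom (Θ h) = (h : KnotGroup))
      ?_ ?_ ?_ ?_ ?_ h
    · rw [hΘa]; rfl
    · rw [hΘb]; rfl
    · simp
    · intro g h hg hh; rw [map_mul, map_mul, hg, hh]; rfl
    · intro g hg; rw [map_inv, map_inv, hg]; rfl
  obtain ⟨f, hf, hfΘ⟩ := exists_cocycle_of_hom ρ _ Θ hΘ
  refine ⟨f, hf, ?_, ?_⟩
  · exact ((affine_injective ρ).1 ((hfΘ _).symm.trans hΘa)).1
  · exact ((affine_injective ρ).1 ((hfΘ _).symm.trans hΘb)).1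

/-- The hypotheses are the crossed-homomorphism rule expanded along xa = bax and xb = babx; they
make the affine lifts of x, a, b satisfy these relations. -/
theorem exists_knot_cocycle (ρ : Representation ℝ KnotGroup V) {u v w : V}
    (h1 : ρ KnotGroup.x v + u = ρ (KnotGroup.b * KnotGroup.a) u + (ρ KnotGroup.b v + w))
    (h2 : ρ KnotGroup.x w + u = ρ (KnotGroup.b * KnotGroup.a * KnotGroup.b) u +
      (ρ (KnotGroup.b * KnotGroup.a) w + (ρ KnotGroup.b v + w))) :
    ∃ f : KnotGroup → V, (∀ g h, f (g * h) = ρ g (f h) + f g) ∧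
      f KnotGroup.x = u ∧ f KnotGroup.a = v ∧ f KnotGroup.b = w := by
  obtain ⟨Θ, hx, ha, hb⟩ := exists_hom_of_conj (X := affine ρ u KnotGroup.x)
    (A := affine ρ v KnotGroup.a) (B := affine ρ w KnotGroup.b)
    (by rw [affine_mul, affine_mul, affine_mul, affine_injective]; exact ⟨h1, x_mul_a⟩)
    (by
      rw [affine_mul, affine_mul, affine_mul, affine_mul, affine_injective]
      exact ⟨h2, x_mul_b⟩)
  have hΘ : SemidirectProduct.rightHom.comp Θ = MonoidHom.id KnotGroup := by
    refine hom_eq_of_x_b ?_ ?_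
    · rw [MonoidHom.comp_apply, hx]; rfl
    · rw [MonoidHom.comp_apply, hb]; rfl
  obtain ⟨f, hf, hfΘ⟩ := exists_cocycle_of_hom ρ _ Θ hΘ
  refine ⟨f, hf, ?_, ?_, ?_⟩
  · exact ((affine_injective ρ).1 ((hfΘ _).symm.trans hx)).1
  · exact ((affine_injective ρ).1 ((hfΘ _).symm.trans ha)).1
  · exact ((affine_injective ρ).1 ((hfΘ _).symm.trans hb)).1

theorem fiber_cocycle_eq_zero {ρ : Representation ℝ KnotGroup V} {f : KnotGroup.fiber → V}
    (hf : ∀ g h : KnotGroup.fiber, f (g * h) = ρ g (f h) + f g)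
    (ha : f ⟨KnotGroup.a, a_mem_fiber⟩ = 0) (hb : f ⟨KnotGroup.b, b_mem_fiber⟩ = 0)
    (h : KnotGroup.fiber) : f h = 0 := by
  have hf' : ∀ g h : KnotGroup.fiber,
      f (g * h) = (ρ.comp KnotGroup.fiber.subtype) g (f h) + f g := hf
  refine fiber_induction (p := fun h => f h = 0) ha hb (cocycle_one hf') (fun g h hg hh => by rw [hf, hg, hh]; simp)
    (fun g hg => by rw [cocycle_inv hf', hg]; simp) h

theorem knot_cocycle_eq_zero {ρ : Representation ℝ KnotGroup V} {f : KnotGroup → V}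
    (hf : ∀ g h, f (g * h) = ρ g (f h) + f g)
    (hx : f KnotGroup.x = 0) (hb : f KnotGroup.b = 0) (g : KnotGroup) : f g = 0 :=
  knotGroup_induction (p := fun g => f g = 0) hx hb (cocycle_one hf) (fun g h hg hh => by rw [hf, hg, hh]; simp)
    (fun g hg => by rw [cocycle_inv hf, hg]; simp) g

end KnotCocycles

/-! ### The dimension of `𝔳` -/

/-- Coordinates on `𝔳`. -/
noncomputable def vModuleEquiv : vModule ≃ₗ[ℝ] (Fin 9 → ℝ) where
  toFun A := ![A.1 0 0, A.1 0 1, A.1 0 2, A.1 0 3, A.1 1 1, A.1 1 2, A.1 1 3, A.1 2 2, A.1 2 3]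
  invFun c := ⟨!![c 0, c 1, c 2, c 3; c 1, c 4, c 5, c 6; c 2, c 5, c 7, c 8;
      -c 3, -c 6, -c 8, -(c 0 + c 4 + c 7)], by
    refine mem_vModule.2 ⟨by simp [Matrix.trace, Fin.sum_univ_four], ?_⟩
    ext i j
    fin_cases i <;> fin_cases j <;> simp [lorentz]⟩
  map_add' A B := by
    ext i
    fin_cases i <;> rfl
  map_smul' r A := by
    ext i
    fin_cases i <;> rfl
  left_inv A := by
    obtain ⟨A, hA⟩ := A
    obtain ⟨h0, h1⟩ := mem_vModule.1 hA
    simp only [Matrix.trace, Matrix.diag_apply, Fin.sum_univ_four] at h0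
    have h (i j) := congrFun (congrFun h1 i) j
    simp only [lorentz, Matrix.mul_diagonal, Matrix.diagonal_mul, Matrix.transpose_apply] at h
    have h01 := h 0 1
    have h02 := h 0 2
    have h03 := h 0 3
    have h12 := h 1 2
    have h13 := h 1 3
    have h23 := h 2 3
    simp at h01 h02 h03 h12 h13 h23
    refine Subtype.ext ?_
    ext i j
    fin_cases i <;> fin_cases j <;> simp <;> linarith
  right_inv c := by
    ext i
    fin_cases i <;> rfl

instance : FiniteDimensional ℝ vModule := Module.Finite.equiv vModuleEquiv.symm

theorem finrank_vModule : Module.finrank ℝ vModule = 9 := by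
  rw [vModuleEquiv.finrank_eq, Module.finrank_fin_fun]

open groupCohomology

/-! ### The first cohomology of the fibre group -/

/-- Without invariants the coboundary map is injective, so the coboundaries have the dimension of
the coefficients. -/
theorem finrank_H1_add_finrank {G : Type} [Group G] (A : Rep.{0} ℝ G)
    [FiniteDimensional ℝ (cocycles₁ A)] (hA : ∀ v : A, (∀ g, A.ρ g v = v) → v = 0) :
    Module.finrank ℝ (H1 A) + Module.finrank ℝ A = Module.finrank ℝ (cocycles₁ A) := by
  let d : A →ₗ[ℝ] cocycles₁ A := (d₀₁ A).hom.codRestrict _ (d₀₁_apply_mem_cocycles₁ (A := A))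
  have hd : Function.Injective d := by
    refine (injective_iff_map_eq_zero d).2 fun v hv => hA v fun g => ?_
    have := congrFun (congrArg Subtype.val hv) g
    exact sub_eq_zero.1 this
  have hπ : Function.Surjective (H1π A).hom := fun c => by
    induction c using H1_induction_on with
    | h f => exact ⟨f, rfl⟩
  have hker : LinearMap.ker (H1π A).hom = LinearMap.range d := by
    ext f
    rw [LinearMap.mem_ker]
    refine (H1π_eq_zero_iff f).trans ⟨?_, ?_⟩
    · rintro ⟨v, hv⟩
      exact ⟨v, Subtype.ext hv⟩
    · rintro ⟨v, rfl⟩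
      exact ⟨v, rfl⟩
  have h := LinearMap.finrank_range_add_finrank_ker (H1π A).hom
  rw [hker, LinearMap.range_eq_top.2 hπ, finrank_top, LinearMap.finrank_range_of_inj hd] at h
  exact h

theorem cocycle_mul {G : Type} [Group G] {A : Rep.{0} ℝ G} (f : cocycles₁ A) (g h : G) :
    f (g * h) = A.ρ g (f h) + f g := (mem_cocycles₁_iff f).1 f.2 g h

/-- The element `a` of the fibre group. -/
def fiberA : KnotGroup.fiber := ⟨KnotGroup.a, a_mem_fiber⟩

/-- The element `b` of the fibre group. -/
def fiberB : KnotGroup.fiber := ⟨KnotGroup.b, b_mem_fiber⟩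

theorem vRepFiber_cocycle_mul {z : DehnFillingSpace} (f : cocycles₁ (vRepFiber z))
    (g h : KnotGroup.fiber) : f (g * h) = adRep z g (f h) + f g := cocycle_mul f g h

theorem vRep_cocycle_mul {z : DehnFillingSpace} (f : cocycles₁ (vRep z)) (g h : KnotGroup) :
    f (g * h) = adRep z g (f h) + f g := cocycle_mul f g h

/-- A crossed homomorphism on the fibre group is determined by its values on `a` and `b`, which are
arbitrary. -/
noncomputable def fiberCocyclesEquiv (z : DehnFillingSpace) :
    cocycles₁ (vRepFiber z) ≃ₗ[ℝ] vModule × vModule :=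
  LinearEquiv.ofBijective
    ({ toFun := fun f => (f fiberA, f fiberB)
       map_add' := fun _ _ => rfl
       map_smul' := fun _ _ => rfl } : cocycles₁ (vRepFiber z) →ₗ[ℝ] vModule × vModule) <| by
    constructor
    · refine (injective_iff_map_eq_zero _).2 fun f hf => ?_
      exact cocycles₁_ext (fiber_cocycle_eq_zero (vRepFiber_cocycle_mul f)
        (congrArg Prod.fst hf) (congrArg Prod.snd hf))
    · rintro ⟨v, w⟩
      obtain ⟨f, hf, ha, hb⟩ := exists_fiber_cocycle (adRep z) v w
      exact ⟨⟨f, (mem_cocycles₁_iff (A := vRepFiber z) f).2 hf⟩, Prod.ext ha hb⟩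

instance (z : DehnFillingSpace) : FiniteDimensional ℝ (cocycles₁ (vRepFiber z)) :=
  Module.Finite.equiv (fiberCocyclesEquiv z).symm

instance (z : DehnFillingSpace) : FiniteDimensional ℝ (H1F z) :=
  Module.Finite.of_surjective (H1π (vRepFiber z)).hom fun c => by
    induction c using H1_induction_on with
    | h f => exact ⟨f, rfl⟩

theorem finrank_H1F (z : DehnFillingSpace) : Module.finrank ℝ (H1F z) = 9 := by
  have h : Module.finrank ℝ (H1F z) + Module.finrank ℝ vModule =
      Module.finrank ℝ (cocycles₁ (vRepFiber z)) :=
    finrank_H1_add_finrank (vRepFiber z) fun v hv => eq_zero_of_adRep_fiber_eq z (A := v) fun γ hγ => hv ⟨γ, hγ⟩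
  rw [(fiberCocyclesEquiv z).finrank_eq, Module.finrank_prod, finrank_vModule] at h
  omega

/-! ### Restriction to the fibre group -/

/-- The restriction of crossed homomorphisms to the fibre group. -/
noncomputable def resCocycle {z : DehnFillingSpace} (f : cocycles₁ (vRep z)) : cocycles₁ (vRepFiber z) :=
  ⟨fun h => f (h : KnotGroup), (mem_cocycles₁_iff (A := vRepFiber z) _).2 fun g h =>
    vRep_cocycle_mul f g h⟩

open CategoryTheory in
theorem resFiber_H1π (z : DehnFillingSpace) (f : cocycles₁ (vRep z)) :
    resFiber z (H1π (vRep z) f) = H1π (vRepFiber z) (resCocycle f) :=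
  H1π_comp_map_apply KnotGroup.fiber.subtype (𝟙 (vRepFiber z)) f

/-- The monodromy on crossed homomorphisms. -/
noncomputable def monodromyCocycle {z : DehnFillingSpace} (f : cocycles₁ (vRepFiber z)) :
    cocycles₁ (vRepFiber z) := mapCocycles₁ conjFiber (coeffMap z) f

theorem monodromyCocycle_apply {z : DehnFillingSpace} (f : cocycles₁ (vRepFiber z))
    (h : KnotGroup.fiber) :
    monodromyCocycle f h = adRep z KnotGroup.x (f (conjFiber h)) := rfl

theorem monodromy_H1π (z : DehnFillingSpace) (f : cocycles₁ (vRepFiber z)) :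
    monodromy z (H1π (vRepFiber z) f) = H1π (vRepFiber z) (monodromyCocycle f) :=
  H1π_comp_map_apply conjFiber (coeffMap z) f

theorem H1π_vRepFiber_eq_iff {z : DehnFillingSpace} (f g : cocycles₁ (vRepFiber z)) :
    H1π (vRepFiber z) f = H1π (vRepFiber z) g ↔
      ∃ v : vModule, ∀ h : KnotGroup.fiber, adRep z h v - v = f h - g h := by
  rw [H1π_eq_iff]
  exact ⟨fun ⟨v, hv⟩ => ⟨v, fun h => congrFun hv h⟩, fun ⟨v, hv⟩ => ⟨v, funext hv⟩⟩

theorem coe_conjFiber (h : KnotGroup.fiber) :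
    (conjFiber h : KnotGroup) = KnotGroup.x⁻¹ * h * KnotGroup.x := by
  simp [conjFiber]

/-- After a coboundary is subtracted, the cocycle k vanishes on the fibre group. Computing k(hx) =
k(x · x⁻¹hx) in two ways shows that k(x) is fixed by every h in the fibre group, hence zero. -/
theorem resFiber_injective (z : DehnFillingSpace) : Function.Injective (resFiber z) := by
  refine (injective_iff_map_eq_zero _).2 fun c hc => ?_
  induction c using H1_induction_on with
  | h f =>
    rw [resFiber_H1π, ← map_zero (H1π (vRepFiber z)).hom] at hc
    obtain ⟨v, hv⟩ := (H1π_vRepFiber_eq_iff (resCocycle f) 0).1 hc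
    let k : KnotGroup → vModule := fun g => f g - (adRep z g v - v)
    have hk : ∀ g h, k (g * h) = adRep z g (k h) + k g := fun g h => by
      simp only [k, vRep_cocycle_mul, map_mul, Module.End.mul_apply, map_sub]
      abel
    have hN : ∀ h ∈ KnotGroup.fiber, k h = 0 := fun h hh => by
      have := hv ⟨h, hh⟩
      change adRep z h v - v = f h - 0 at this
      simp only [k, this, sub_zero, sub_self]
    have hkx : k KnotGroup.x = 0 := by
      refine eq_zero_of_adRep_fiber_eq z fun h hh => ?_
      have h1 := hk h KnotGroup.x
      have h2 := hk KnotGroup.x (KnotGroup.x⁻¹ * h * KnotGroup.x)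
      have hh' : KnotGroup.x⁻¹ * h * KnotGroup.x ∈ KnotGroup.fiber := by
        simpa using KnotGroup.fiber_normal.conj_mem h hh KnotGroup.x⁻¹
      rw [hN _ hh, add_zero] at h1
      rw [hN _ hh', map_zero, zero_add, ← mul_assoc, mul_inv_cancel_left, h1] at h2
      exact h2
    have h0 := knot_cocycle_eq_zero hk hkx (hN _ b_mem_fiber)
    refine (H1π_eq_zero_iff f).2 ⟨v, funext fun g => ?_⟩
    exact (sub_eq_zero.1 (h0 g)).symm

/-- On the fibre group, x f - f is the coboundary of f(x). -/
theorem resFiber_mem_fixedClasses (z : DehnFillingSpace) (c : H1M z) :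
    resFiber z c ∈ fixedClasses z := by
  induction c using H1_induction_on with
  | h f =>
    rw [resFiber_H1π]
    change monodromy z _ = _
    rw [monodromy_H1π]
    refine (H1π_vRepFiber_eq_iff _ _).2 ⟨f KnotGroup.x, fun h => ?_⟩
    rw [monodromyCocycle_apply]
    change _ = adRep z KnotGroup.x (f (conjFiber h : KnotGroup)) - f (h : KnotGroup)
    have h1 := vRep_cocycle_mul f KnotGroup.x (conjFiber h)
    rw [coe_conjFiber, ← mul_assoc, mul_inv_cancel_left, vRep_cocycle_mul] at h1
    rw [coe_conjFiber, ← sub_eq_iff_eq_add.2 h1]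
    abel

/-- A vector v with x f - f = δv is the value to assign to x: on h = ba and h = bab this equation
becomes the two relations needed to extend f. -/
theorem exists_resFiber_eq (z : DehnFillingSpace) {c : H1F z} (hc : c ∈ fixedClasses z) :
    ∃ d, resFiber z d = c := by
  induction c using H1_induction_on with
  | h f =>
    change monodromy z _ = _ at hc
    rw [monodromy_H1π] at hc
    obtain ⟨v, hv⟩ := (H1π_vRepFiber_eq_iff _ _).1 hc
    have hconj (g h : KnotGroup.fiber) (e : KnotGroup.x * g * KnotGroup.x⁻¹ = h) :
        adRep z KnotGroup.x (f g) + v = adRep z h v + f h := by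
      have h1 := hv h
      rw [monodromyCocycle_apply] at h1
      have h2 : conjFiber h = g := Subtype.ext (by rw [coe_conjFiber, ← e]; group)
      rw [h2] at h1
      exact (sub_eq_sub_iff_add_eq_add.1 h1).symm
    obtain ⟨k, hk, hx, ha, hb⟩ := exists_knot_cocycle (adRep z) (u := v) (v := f fiberA)
      (w := f fiberB)
      (by
        have h1 := hconj fiberA (fiberB * fiberA) KnotGroup.conj_a
        rwa [vRepFiber_cocycle_mul] at h1)
      (by
        have h1 := hconj fiberB (fiberB * fiberA * fiberB) KnotGroup.conj_b
        rwa [vRepFiber_cocycle_mul, vRepFiber_cocycle_mul] at h1)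
    refine ⟨H1π (vRep z) ⟨k, (mem_cocycles₁_iff (A := vRep z) k).2 hk⟩, ?_⟩
    rw [resFiber_H1π]
    congr 1
    refine (fiberCocyclesEquiv z).injective (Prod.ext ?_ ?_)
    · exact ha
    · exact hb

/-- The restriction as an isomorphism onto the classes that are fixed by the monodromy. -/
noncomputable def resFiberEquiv (z : DehnFillingSpace) : H1M z ≃ₗ[ℝ] fixedClasses z :=
  LinearEquiv.ofBijective ((resFiber z).codRestrict _ (resFiber_mem_fixedClasses z))
    ⟨fun _ _ h => resFiber_injective z (congrArg Subtype.val h), fun ⟨_, hc⟩ =>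
      (exists_resFiber_eq z hc).imp fun _ hd => Subtype.ext hd⟩

theorem finrank_eq_one_iff_existsUnique {E : Type*} [AddCommGroup E] [Module ℝ E]
    [FiniteDimensional ℝ E] (W : Submodule ℝ E) :
    Module.finrank ℝ W = 1 ↔ ∃! L : Submodule ℝ E, Module.finrank ℝ L = 1 ∧ L ≤ W := by
  constructor
  · intro h
    exact ⟨W, ⟨h, le_rfl⟩, fun L ⟨h1, h2⟩ => Submodule.eq_of_le_of_finrank_eq h2 (h1.trans h.symm)⟩
  · rintro ⟨L, ⟨h1, h2⟩, hu⟩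
    have : L = W := by
      refine le_antisymm h2 fun v hv => ?_
      by_cases h0 : v = 0
      · rw [h0]; exact L.zero_mem
      -- A nonzero vector of `W` spans a line in `W`, which uniqueness identifies with `L`.
      · rw [← hu (ℝ ∙ v) ⟨finrank_span_singleton h0,
          (Submodule.span_singleton_le_iff_mem v W).2 hv⟩]
        exact Submodule.mem_span_singleton_self v
    rw [← this, h1]

/-! ### The trace pairing on `𝔳` -/

theorem lorentz_mul_self : lorentz * lorentz = 1 := by
  rw [lorentz, Matrix.diagonal_mul_diagonal, ← Matrix.diagonal_one]
  congr 1
  ext i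
  fin_cases i <;> simp

theorem hol_inv_coe (z : DehnFillingSpace) (γ : KnotGroup) :
    ((hol z γ)⁻¹ : GL (Fin 4) ℝ).1 = lorentz * (hol z γ).1ᵀ * lorentz := by
  have e2 : (hol z γ).1 * ((hol z γ)⁻¹ : GL (Fin 4) ℝ).1 = 1 := (hol z γ).mul_inv
  have hg := congrArg (fun A => lorentz * A * ((hol z γ)⁻¹ : GL (Fin 4) ℝ).1) (hol_lorentz z γ)
  simp only [← Matrix.mul_assoc, lorentz_mul_self, Matrix.one_mul] at hg
  rw [← hg, Matrix.mul_assoc _ (hol z γ).1, e2, Matrix.mul_one]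

theorem adRep_coe (z : DehnFillingSpace) (γ : KnotGroup) (A : vModule) :
    (adRep z γ A : Matrix (Fin 4) (Fin 4) ℝ) =
      (hol z γ).1 * A.1 * ((hol z γ)⁻¹ : GL (Fin 4) ℝ).1 := rfl

/-- The trace pairing on `𝔳`. -/
noncomputable def tracePairing : vModule →ₗ[ℝ] vModule →ₗ[ℝ] ℝ :=
  LinearMap.mk₂ ℝ (fun A B => (A.1 * B.1).trace)
    (fun A B C => by simp [Matrix.add_mul]) (fun r A B => by simp)
    (fun A B C => by simp [Matrix.mul_add]) (fun r A B => by simp)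

theorem tracePairing_apply (A B : vModule) : tracePairing A B = (A.1 * B.1).trace := rfl

theorem tracePairing_adRep (z : DehnFillingSpace) (γ : KnotGroup) (A B : vModule) :
    tracePairing (adRep z γ A) (adRep z γ B) = tracePairing A B := by
  have e1 : ((hol z γ)⁻¹ : GL (Fin 4) ℝ).1 * (hol z γ).1 = 1 := (hol z γ).inv_mul
  simp only [tracePairing_apply, adRep_coe]
  generalize ((hol z γ)⁻¹ : GL (Fin 4) ℝ).1 = k at *
  generalize (hol z γ).1 = g at *
  calc (g * A.1 * k * (g * B.1 * k)).trace = (g * (A.1 * (k * g) * (B.1 * k))).trace := by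
        simp only [Matrix.mul_assoc]
    _ = (A.1 * B.1 * (k * g)).trace := by
        rw [e1, Matrix.mul_one, Matrix.trace_mul_comm]; simp only [Matrix.mul_assoc, e1]
    _ = (A.1 * B.1).trace := by rw [e1, Matrix.mul_one]

/-- The trace pairing is indefinite, but `𝔳` is closed under transposition, and pairing B with Bᵀ
gives the sum of squares of its entries. -/
theorem eq_zero_of_tracePairing {B : vModule} (h : ∀ A, tracePairing A B = 0) : B = 0 := by
  obtain ⟨B, hB⟩ := B
  obtain ⟨h0, h1⟩ := mem_vModule.1 hB
  have hBt : Bᵀ = lorentz * B * lorentz := by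
    rw [← h1, Matrix.mul_assoc, lorentz_mul_self, Matrix.mul_one]
  have hmem : Bᵀ ∈ vModule := by
    refine mem_vModule.2 ⟨by rw [Matrix.trace_transpose, h0], ?_⟩
    rw [Matrix.transpose_transpose, hBt, ← Matrix.mul_assoc, ← Matrix.mul_assoc, lorentz_mul_self,
      Matrix.one_mul]
  have h2 : (Bᴴ * B).trace = 0 := by
    rw [Matrix.conjTranspose_eq_transpose_of_trivial]
    exact h ⟨Bᵀ, hmem⟩
  exact Subtype.ext (Matrix.trace_conjTranspose_mul_self_eq_zero_iff.1 h2)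

/-- By invariance of the pairing, the orthogonal complement of (γ - 1)`𝔳` is the fixed space of γ.
-/
theorem adRep_eq_of_tracePairing (z : DehnFillingSpace) {γ : KnotGroup} {B : vModule}
    (h : ∀ A, tracePairing (adRep z γ A - A) B = 0) : adRep z γ B = B := by
  refine sub_eq_zero.1 (eq_zero_of_tracePairing fun A => ?_)
  have h1 := h (adRep z γ⁻¹ A)
  have e : adRep z γ (adRep z γ⁻¹ A) = A := by simp
  have h2 := tracePairing_adRep z γ (adRep z γ⁻¹ A) B
  rw [e] at h1 h2
  rw [map_sub, LinearMap.sub_apply] at h1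
  rw [map_sub, h2]
  linarith

/-! ### An invariant of the peripheral group -/

/-- The trace-free part of `ρ(x) + ρ(x)⁻¹`, which is invariant under the peripheral group. -/
noncomputable def peripheralInvariant (z : DehnFillingSpace) : vModule :=
  ⟨(hol z KnotGroup.x).1 + ((hol z KnotGroup.x)⁻¹ : GL (Fin 4) ℝ).1 -
      ((hol z KnotGroup.x).1.trace / 2) • 1, by
    have ht : lorentzᵀ = lorentz := Matrix.diagonal_transpose _
    rw [hol_inv_coe]
    generalize (hol z KnotGroup.x).1 = g
    refine mem_vModule.2 ⟨?_, ?_⟩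
    · rw [Matrix.trace_sub, Matrix.trace_add, Matrix.trace_mul_comm, ← Matrix.mul_assoc,
        lorentz_mul_self, Matrix.one_mul, Matrix.trace_transpose, Matrix.trace_smul,
        Matrix.trace_one]
      simp
      ring
    · have e1 : lorentz * (lorentz * gᵀ * lorentz) = gᵀ * lorentz := by
        rw [← Matrix.mul_assoc, ← Matrix.mul_assoc, lorentz_mul_self, Matrix.one_mul]
      have e2 : (lorentz * gᵀ * lorentz)ᵀ * lorentz = lorentz * g := by
        simp only [Matrix.transpose_mul, Matrix.transpose_transpose, ht]
        rw [← Matrix.mul_assoc, Matrix.mul_assoc _ lorentz lorentz, lorentz_mul_self, Matrix.mul_one]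
      simp only [Matrix.transpose_sub, Matrix.transpose_add, Matrix.transpose_smul,
        Matrix.transpose_one, Matrix.sub_mul, Matrix.add_mul, Matrix.mul_sub, Matrix.mul_add, e1, e2,
        Matrix.smul_mul, Matrix.mul_smul, Matrix.one_mul, Matrix.mul_one]
      abel⟩

theorem peripheralInvariant_coe (z : DehnFillingSpace) :
    (peripheralInvariant z).1 = (hol z KnotGroup.x).1 + ((hol z KnotGroup.x)⁻¹ : GL (Fin 4) ℝ).1 -
      ((hol z KnotGroup.x).1.trace / 2) • 1 := rfl

theorem adRep_peripheralInvariant (z : DehnFillingSpace) {γ : KnotGroup}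
    (hγ : γ * KnotGroup.x = KnotGroup.x * γ) :
    adRep z γ (peripheralInvariant z) = peripheralInvariant z := by
  refine Subtype.ext ?_
  have e2 : (hol z γ).1 * ((hol z γ)⁻¹ : GL (Fin 4) ℝ).1 = 1 := (hol z γ).mul_inv
  have hc : Commute (hol z γ) (hol z KnotGroup.x) := by
    rw [Commute, SemiconjBy, ← map_mul, hγ, map_mul]
  have h1 : (hol z γ).1 * (hol z KnotGroup.x).1 = (hol z KnotGroup.x).1 * (hol z γ).1 :=
    congrArg Units.val hc
  have h2 : (hol z γ).1 * ((hol z KnotGroup.x)⁻¹ : GL (Fin 4) ℝ).1 =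
      ((hol z KnotGroup.x)⁻¹ : GL (Fin 4) ℝ).1 * (hol z γ).1 :=
    congrArg Units.val hc.inv_right
  have h3 : (hol z γ).1 * (peripheralInvariant z).1 = (peripheralInvariant z).1 * (hol z γ).1 := by
    rw [peripheralInvariant_coe]
    simp only [Matrix.mul_sub, Matrix.mul_add, Matrix.sub_mul, Matrix.add_mul, h1, h2,
      Matrix.mul_smul, Matrix.smul_mul, Matrix.mul_one, Matrix.one_mul]
  rw [adRep_coe, h3, Matrix.mul_assoc, e2, Matrix.mul_one]

/-- Vanishing of the entries (0,2) and (1,2) forces m = 1, and then the entry (2,3) is nonzero; this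
covers the parabolic case as well. -/
theorem peripheralInvariant_ne_zero (z : DehnFillingSpace) : peripheralInvariant z ≠ 0 := by
  intro h
  have h0 := congrArg Subtype.val h
  rw [peripheralInvariant_coe, hol_inv_coe, hol_x] at h0
  have hm := norm_pos_iff.2 (shape_ne_zero z)
  generalize z.1.1 * (1 - z.1.2) = m at *
  have hc : (8 * ‖m‖)⁻¹ ≠ 0 := by positivity
  have h02 := congrFun (congrFun h0 0) 2
  have h12 := congrFun (congrFun h0 1) 2
  have h23 := congrFun (congrFun h0 2) 3
  simp [lorentz, Matrix.diagonal_mul, Matrix.mul_diagonal] at h02 h12 h23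
  have e1 : m.re = 1 := by
    field_simp at h02
    linarith
  have e2 : m.im = 0 := by
    rcases h12 with h12 | h12
    · exact absurd h12 (norm_pos_iff.1 hm)
    · exact h12
  have e3 : ‖m‖ = 1 := by
    have : m = 1 := Complex.ext e1 e2
    simp [this]
  rw [e3] at h23
  norm_num at h23

/-! ### The cohomology of the knot complement does not vanish -/

theorem longitude_comm_x :
    KnotGroup.a⁻¹ * KnotGroup.b⁻¹ * KnotGroup.a * KnotGroup.b * KnotGroup.x =
      KnotGroup.x * (KnotGroup.a⁻¹ * KnotGroup.b⁻¹ * KnotGroup.a * KnotGroup.b) := by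
  have e : KnotGroup.x * (KnotGroup.a⁻¹ * KnotGroup.b⁻¹ * KnotGroup.a * KnotGroup.b) =
      (KnotGroup.x * KnotGroup.a * KnotGroup.x⁻¹)⁻¹ * (KnotGroup.x * KnotGroup.b * KnotGroup.x⁻¹)⁻¹ *
      (KnotGroup.x * KnotGroup.a * KnotGroup.x⁻¹) * (KnotGroup.x * KnotGroup.b * KnotGroup.x⁻¹) *
      KnotGroup.x := by group
  rw [e, KnotGroup.conj_a, KnotGroup.conj_b]
  group

/-- The longitude, as an element of the fibre group. -/
def longitude : KnotGroup.fiber := fiberA⁻¹ * fiberB⁻¹ * fiberA * fiberB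

theorem coe_longitude : (longitude : KnotGroup) =
    KnotGroup.a⁻¹ * KnotGroup.b⁻¹ * KnotGroup.a * KnotGroup.b := rfl

theorem conjFiber_longitude : conjFiber longitude = longitude := by
  refine Subtype.ext ?_
  rw [coe_conjFiber, mul_assoc, coe_longitude, longitude_comm_x, inv_mul_cancel_left]

/-- The cocycle rule is applied to ba · ℓ = ab, where ℓ = a⁻¹b⁻¹ab is the boundary of the fibre. -/
theorem cocycle_longitude {z : DehnFillingSpace} (f : cocycles₁ (vRepFiber z)) :
    adRep z (KnotGroup.b * KnotGroup.a) (f longitude) =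
      (f fiberA - adRep z KnotGroup.b (f fiberA)) + (adRep z KnotGroup.a (f fiberB) - f fiberB) := by
  have h1 := vRepFiber_cocycle_mul f (fiberB * fiberA) longitude
  have e : fiberB * fiberA * longitude = fiberA * fiberB := by
    rw [longitude]; group
  rw [e, vRepFiber_cocycle_mul, vRepFiber_cocycle_mul] at h1
  change adRep z KnotGroup.a (f fiberB) + f fiberA =
    adRep z (KnotGroup.b * KnotGroup.a) (f longitude) +
      (adRep z KnotGroup.b (f fiberA) + f fiberB) at h1
  rw [← sub_eq_iff_eq_add.2 h1]
  abel

/-- Otherwise the translate of the invariant by ba is orthogonal to the images of 1 - b and a - 1,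
hence fixed by a and b, hence zero. Freeness supplies arbitrary values on a and b. -/
theorem exists_tracePairing_longitude_ne_zero (z : DehnFillingSpace) :
    ∃ f : cocycles₁ (vRepFiber z), tracePairing (f longitude) (peripheralInvariant z) ≠ 0 := by
  by_contra! hc
  set w := adRep z (KnotGroup.b * KnotGroup.a) (peripheralInvariant z) with hw
  have h (u v : vModule) : tracePairing
      ((u - adRep z KnotGroup.b u) + (adRep z KnotGroup.a v - v)) w = 0 := by
    obtain ⟨f, hf⟩ := (fiberCocyclesEquiv z).surjective (u, v)
    have hu : f fiberA = u := congrArg Prod.fst hf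
    have hv : f fiberB = v := congrArg Prod.snd hf
    rw [← hu, ← hv, ← cocycle_longitude, hw, tracePairing_adRep, hc]
  have ha : adRep z KnotGroup.a w = w := adRep_eq_of_tracePairing z fun A => by
    simpa using h 0 A
  have hb : adRep z KnotGroup.b w = w := adRep_eq_of_tracePairing z fun A => by
    have := h A 0
    rw [map_zero, sub_zero, add_zero] at this
    rw [← neg_sub, map_neg, LinearMap.neg_apply, this, neg_zero]
  have hw0 : w = 0 := eq_zero_of_adRep_fiber_eq z fun γ hγ =>
    fiber_induction (p := fun h => adRep z h w = w) ha hb (by simp)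
      (fun g h hg hh => by
        change adRep z (g * h : KnotGroup) w = w
        rw [map_mul, Module.End.mul_apply, hh, hg])
      (fun g hg => by
        change adRep z (g : KnotGroup)⁻¹ w = w
        nth_rewrite 1 [← hg]
        simp) ⟨γ, hγ⟩
  refine peripheralInvariant_ne_zero z ?_
  have := congrArg (adRep z (KnotGroup.b * KnotGroup.a)⁻¹) hw0
  rw [hw, map_zero, ← Module.End.mul_apply, ← map_mul, inv_mul_cancel, map_one] at this
  exact this

/-- The meridian commutes with the longitude and fixes the peripheral invariant, so the functional
does not see the monodromy. -/
theorem tracePairing_longitude_monodromyCocycle {z : DehnFillingSpace}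
    (f : cocycles₁ (vRepFiber z)) :
    tracePairing (monodromyCocycle f longitude) (peripheralInvariant z) =
      tracePairing (f longitude) (peripheralInvariant z) := by
  rw [monodromyCocycle_apply, conjFiber_longitude]
  nth_rewrite 1 [← adRep_peripheralInvariant z (γ := KnotGroup.x) rfl]
  exact tracePairing_adRep z _ _ _

theorem tracePairing_longitude_coboundary (z : DehnFillingSpace) (v : vModule) :
    tracePairing (adRep z longitude v - v) (peripheralInvariant z) = 0 := by
  have h := tracePairing_adRep z longitude v (peripheralInvariant z)
  rw [adRep_peripheralInvariant z (by rw [coe_longitude]; exact longitude_comm_x)] at h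
  rw [map_sub, LinearMap.sub_apply, h, sub_self]

/-- The longitude functional kills coboundaries and the image of the monodromy minus the identity,
yet is nonzero. So that endomorphism of the finite-dimensional H¹(F) is not surjective, hence not
injective. -/
theorem finrank_H1M_pos (z : DehnFillingSpace) : 0 < Module.finrank ℝ (H1M z) := by
  rw [(resFiberEquiv z).finrank_eq]
  by_contra hc
  have hbot : fixedClasses z = ⊥ := Submodule.finrank_eq_zero.1 (by omega)
  have hinj : Function.Injective (monodromy z - LinearMap.id : Module.End ℝ (H1F z)) := by
    refine (injective_iff_map_eq_zero _).2 fun c h0 => ?_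
    have : c ∈ fixedClasses z := sub_eq_zero.1 h0
    rwa [hbot] at this
  obtain ⟨f, hf⟩ := exists_tracePairing_longitude_ne_zero z
  obtain ⟨c, hc⟩ := LinearMap.surjective_of_injective hinj (H1π (vRepFiber z) f)
  induction c using H1_induction_on with
  | h g =>
    rw [LinearMap.sub_apply, monodromy_H1π, LinearMap.id_apply] at hc
    have hc' : H1π (vRepFiber z) (monodromyCocycle g - g) = H1π (vRepFiber z) f :=
      (map_sub (H1π (vRepFiber z)).hom _ _).trans hc
    obtain ⟨v, hv⟩ := (H1π_vRepFiber_eq_iff _ _).1 hc'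
    have h1 := hv longitude
    change _ = monodromyCocycle g longitude - g longitude - f longitude at h1
    have h2 := congrArg (fun A => tracePairing A (peripheralInvariant z)) h1
    simp only [map_sub, LinearMap.sub_apply, tracePairing_longitude_monodromyCocycle] at h2
    have h3 := tracePairing_longitude_coboundary z v
    rw [map_sub, LinearMap.sub_apply] at h3
    exact hf (by linarith)

/-! ### Openness in the space of shapes -/

theorem isOpen_finrank_ker_le {T E F : Type*} [TopologicalSpace T]
    [NormedAddCommGroup E] [NormedSpace ℝ E] [FiniteDimensional ℝ E]
    [NormedAddCommGroup F] [NormedSpace ℝ F] [FiniteDimensional ℝ F]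
    (Φ : T → E →ₗ[ℝ] F) (hΦ : ∀ v, Continuous fun t => Φ t v) (n : ℕ) :
    IsOpen {t | Module.finrank ℝ (LinearMap.ker (Φ t)) ≤ n} := by
  have hc : Continuous fun t => LinearMap.toContinuousLinearMap (Φ t) :=
    continuous_clm_apply.2 hΦ
  -- Rank is lower semicontinuous. The subtraction is truncated, which is harmless: for `n` at least
  -- the dimension both conditions always hold.
  have h := (isOpen_setOfPred_nat_le_rank (𝕜 := ℝ) (E := E) (F := F)
    (Module.finrank ℝ E - n)).preimage hc
  convert h using 1
  ext t
  have h1 := LinearMap.finrank_range_add_finrank_ker (Φ t)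
  change _ ↔ ((Module.finrank ℝ E - n : ℕ) : Cardinal) ≤ LinearMap.rank (Φ t)
  rw [LinearMap.rank, ← Module.finrank_eq_rank, Nat.cast_le]
  change Module.finrank ℝ (LinearMap.ker (Φ t)) ≤ n ↔ _
  omega

/-- The square root of m has disappeared from the explicit matrices of x and y, so these are visibly
continuous, and inversion is g ↦ J gᵀ J for the Lorentz matrix J. -/
theorem continuous_hol (γ : KnotGroup) :
    Continuous fun z : DehnFillingSpace => (hol z γ : Matrix (Fin 4) (Fin 4) ℝ) := by
  have hmul (g h : KnotGroup)
      (hg : Continuous fun z : DehnFillingSpace => (hol z g : Matrix (Fin 4) (Fin 4) ℝ))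
      (hh : Continuous fun z : DehnFillingSpace => (hol z h : Matrix (Fin 4) (Fin 4) ℝ)) :
      Continuous fun z : DehnFillingSpace => (hol z (g * h) : Matrix (Fin 4) (Fin 4) ℝ) := by
    simp only [map_mul, Units.val_mul]
    exact hg.matrix_mul hh
  have hinv (g : KnotGroup)
      (hg : Continuous fun z : DehnFillingSpace => (hol z g : Matrix (Fin 4) (Fin 4) ℝ)) :
      Continuous fun z : DehnFillingSpace => (hol z g⁻¹ : Matrix (Fin 4) (Fin 4) ℝ) := by
    simp only [map_inv, hol_inv_coe]
    exact (continuous_const.matrix_mul hg.matrix_transpose).matrix_mul continuous_const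
  have hm : Continuous fun z : DehnFillingSpace => z.1.1 * (1 - z.1.2) := by fun_prop
  have hx : Continuous fun z : DehnFillingSpace =>
      (hol z KnotGroup.x : Matrix (Fin 4) (Fin 4) ℝ) := by
    simp only [hol_x]
    refine ((continuous_const.mul hm.norm).inv₀ fun z => ?_).smul ?_
    · exact mul_ne_zero (by norm_num) (norm_ne_zero_iff.2 (shape_ne_zero z))
    · refine continuous_matrix fun i j => ?_
      fin_cases i <;> fin_cases j <;> simp only [Matrix.of_apply] <;> simp <;> fun_prop
  have hy : Continuous fun z : DehnFillingSpace =>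
      (hol z KnotGroup.y : Matrix (Fin 4) (Fin 4) ℝ) := by
    simp only [hol_y]
    refine ((continuous_const.mul hm.norm).inv₀ fun z => ?_).smul ?_
    · exact mul_ne_zero (by norm_num) (norm_ne_zero_iff.2 (shape_ne_zero z))
    · refine continuous_matrix fun i j => ?_
      fin_cases i <;> fin_cases j <;> simp only [Matrix.of_apply] <;> simp <;> fun_prop
  have h1 : Continuous fun z : DehnFillingSpace => (hol z 1 : Matrix (Fin 4) (Fin 4) ℝ) := by
    simp only [map_one]
    exact continuous_const
  exact knotGroup_induction (p := fun γ => Continuous fun z : DehnFillingSpace =>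
    (hol z γ : Matrix (Fin 4) (Fin 4) ℝ)) hx (hmul _ _ hx (hinv _ hy)) h1 hmul hinv γ

theorem continuous_vModuleEquiv_adRep (γ : KnotGroup) (v : vModule) :
    Continuous fun z : DehnFillingSpace => vModuleEquiv (adRep z γ v) := by
  have h : Continuous fun z : DehnFillingSpace => (adRep z γ v : Matrix (Fin 4) (Fin 4) ℝ) := by
    simp only [adRep_coe, hol_inv_coe]
    have hc := continuous_hol γ
    exact (hc.matrix_mul continuous_const).matrix_mul
      ((continuous_const.matrix_mul hc.matrix_transpose).matrix_mul continuous_const)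
  refine continuous_pi fun i => ?_
  fin_cases i
  exacts [h.matrix_elem 0 0, h.matrix_elem 0 1, h.matrix_elem 0 2, h.matrix_elem 0 3,
    h.matrix_elem 1 1, h.matrix_elem 1 2, h.matrix_elem 1 3, h.matrix_elem 2 2, h.matrix_elem 2 3]

/-- The obstruction for the values `u`, `v`, `w` on `x`, `a`, `b` to extend to a crossed
homomorphism of the knot group. -/
noncomputable def cocycleObstruction (z : DehnFillingSpace) :
    (vModule × vModule × vModule) →ₗ[ℝ] (vModule × vModule) where
  toFun p :=
    (adRep z KnotGroup.x p.2.1 + p.1 -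
      (adRep z (KnotGroup.b * KnotGroup.a) p.1 + (adRep z KnotGroup.b p.2.1 + p.2.2)),
    adRep z KnotGroup.x p.2.2 + p.1 -
      (adRep z (KnotGroup.b * KnotGroup.a * KnotGroup.b) p.1 +
        (adRep z (KnotGroup.b * KnotGroup.a) p.2.2 + (adRep z KnotGroup.b p.2.1 + p.2.2))))
  map_add' p q := by
    ext1 <;> simp only [Prod.fst_add, Prod.snd_add, map_add] <;> abel
  map_smul' c p := by
    ext1 <;> simp only [Prod.smul_fst, Prod.smul_snd, map_smul, RingHom.id_apply] <;> module

/-- The values on `x`, `a`, `b` identify the crossed homomorphisms of the knot group with the kernel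
of the obstruction. -/
noncomputable def knotCocyclesEquiv (z : DehnFillingSpace) :
    cocycles₁ (vRep z) ≃ₗ[ℝ] LinearMap.ker (cocycleObstruction z) :=
  LinearEquiv.ofBijective
    (LinearMap.codRestrict _
      ({ toFun := fun f => (f KnotGroup.x, f KnotGroup.a, f KnotGroup.b)
         map_add' := fun _ _ => rfl
         map_smul' := fun _ _ => rfl } :
        cocycles₁ (vRep z) →ₗ[ℝ] vModule × vModule × vModule)
      fun f => by
        have h1 := congrArg f x_mul_a
        have h2 := congrArg f x_mul_b
        simp only [vRep_cocycle_mul] at h1 h2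
        exact Prod.ext (sub_eq_zero.2 h1) (sub_eq_zero.2 h2)) <| by
    constructor
    · refine (injective_iff_map_eq_zero _).2 fun f hf => ?_
      have h := congrArg Subtype.val hf
      exact cocycles₁_ext (knot_cocycle_eq_zero (vRep_cocycle_mul f) (congrArg Prod.fst h)
        (congrArg (fun p => p.2.2) h))
    · rintro ⟨⟨u, v, w⟩, hp⟩
      obtain ⟨f, hf, hx, ha, hb⟩ := exists_knot_cocycle (adRep z)
        (sub_eq_zero.1 (congrArg Prod.fst hp)) (sub_eq_zero.1 (congrArg Prod.snd hp))
      exact ⟨⟨f, (mem_cocycles₁_iff (A := vRep z) f).2 hf⟩,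
        Subtype.ext (Prod.ext hx (Prod.ext ha hb))⟩

instance (z : DehnFillingSpace) : FiniteDimensional ℝ (cocycles₁ (vRep z)) :=
  Module.Finite.equiv (knotCocyclesEquiv z).symm

theorem finrank_H1M_add (z : DehnFillingSpace) : Module.finrank ℝ (H1M z) + 9 =
    Module.finrank ℝ (LinearMap.ker (cocycleObstruction z)) := by
  have h : Module.finrank ℝ (H1M z) + Module.finrank ℝ vModule =
      Module.finrank ℝ (cocycles₁ (vRep z)) :=
    finrank_H1_add_finrank (vRep z) fun v hv =>
      eq_zero_of_adRep_fiber_eq z (A := v) fun γ _ => hv γ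
  rw [← (knotCocyclesEquiv z).finrank_eq, ← h, finrank_vModule]

theorem isOpen_finrank_H1M_eq_one :
    IsOpen {z : DehnFillingSpace | Module.finrank ℝ (H1M z) = 1} := by
  let e := vModuleEquiv.prodCongr (vModuleEquiv.prodCongr vModuleEquiv)
  let e' := vModuleEquiv.prodCongr vModuleEquiv
  have h := isOpen_finrank_ker_le
    -- The bound 10 is 1 + 9: crossed homomorphisms exceed H¹(M) by the nine dimensions of
    -- coboundaries. Coordinates replace `𝔳` by a fixed normed space.
    (fun z => e'.toLinearMap ∘ₗ cocycleObstruction z ∘ₗ e.symm.toLinearMap) (fun p => ?_) 10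
  · convert h using 1
    ext z
    have h1 := finrank_H1M_add z
    have h2 := finrank_H1M_pos z
    have h3 : Module.finrank ℝ (LinearMap.ker
        (e'.toLinearMap ∘ₗ cocycleObstruction z ∘ₗ e.symm.toLinearMap)) =
        Module.finrank ℝ (LinearMap.ker (cocycleObstruction z)) := by
      rw [LinearEquiv.ker_comp, LinearMap.ker_comp, Submodule.comap_equiv_eq_map_symm]
      exact LinearEquiv.finrank_map_eq _ _
    change Module.finrank ℝ (H1M z) = 1 ↔ Module.finrank ℝ (LinearMap.ker
      (e'.toLinearMap ∘ₗ cocycleObstruction z ∘ₗ e.symm.toLinearMap)) ≤ 10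
    rw [h3]
    omega
  · simp only [LinearMap.comp_apply, LinearEquiv.coe_coe]
    generalize e.symm p = q
    have hc := fun γ v => continuous_vModuleEquiv_adRep γ v
    refine Continuous.prodMk (f := fun z => vModuleEquiv (cocycleObstruction z q).1)
      (g := fun z => vModuleEquiv (cocycleObstruction z q).2) ?_ ?_ <;>
      simp only [cocycleObstruction, LinearMap.coe_mk, AddHom.coe_mk, map_add, map_sub]
    · exact ((hc _ _).add continuous_const).sub ((hc _ _).add ((hc _ _).add continuous_const))
    · exact ((hc _ _).add continuous_const).sub
        ((hc _ _).add ((hc _ _).add ((hc _ _).add continuous_const)))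

/-! ### Openness in the meridian coordinate -/

section MeridianCoordinate

open Filter Topology

/-- The left-hand side of the first edge equation. -/
noncomputable def edgeSum₁ (z : ℂ × ℂ) : ℂ :=
  2 * Complex.log z.1 + Complex.log (1 / (1 - z.1)) + Complex.log z.2 + 2 * Complex.log (1 - 1 / z.2)

/-- The left-hand side of the second edge equation. -/
noncomputable def edgeSum₂ (z : ℂ × ℂ) : ℂ :=
  Complex.log (1 / (1 - z.1)) + 2 * Complex.log (1 - 1 / z.1) + Complex.log z.2 +
    2 * Complex.log (1 / (1 - z.2))

theorem continuousAt_log_of_im_pos {p : ℂ} (h : 0 < p.im) : ContinuousAt Complex.log p :=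
  continuousAt_clog (Or.inr h.ne')

theorem continuousAt_log_one_div_one_sub {p : ℂ} (h : 0 < p.im) :
    ContinuousAt (fun p => Complex.log (1 / (1 - p))) p :=
  ContinuousAt.comp' (f := fun p => 1 / (1 - p)) (continuousAt_log_of_im_pos (im_one_div_one_sub_pos h))
    (continuousAt_const.div (continuousAt_const.sub continuousAt_id) (ne_zero_of_im_pos h).2)

theorem continuousAt_log_one_sub_one_div {p : ℂ} (h : 0 < p.im) :
    ContinuousAt (fun p => Complex.log (1 - 1 / p)) p :=
  ContinuousAt.comp' (f := fun p => 1 - 1 / p) (continuousAt_log_of_im_pos (im_one_sub_one_div_pos h))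
    (continuousAt_const.sub (continuousAt_const.div continuousAt_id (ne_zero_of_im_pos h).1))

theorem continuousAt_edgeSum {z : ℂ × ℂ} (h1 : 0 < z.1.im) (h2 : 0 < z.2.im) :
    ContinuousAt edgeSum₁ z ∧ ContinuousAt edgeSum₂ z := by
  have c1 : ContinuousAt (fun z : ℂ × ℂ => z.1) z := continuousAt_fst
  have c2 : ContinuousAt (fun z : ℂ × ℂ => z.2) z := continuousAt_snd
  have a1 := ContinuousAt.comp' (f := fun z : ℂ × ℂ => z.1) (continuousAt_log_of_im_pos h1) c1
  have a2 := ContinuousAt.comp' (f := fun z : ℂ × ℂ => z.1) (continuousAt_log_one_div_one_sub h1) c1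
  have a3 := ContinuousAt.comp' (f := fun z : ℂ × ℂ => z.1) (continuousAt_log_one_sub_one_div h1) c1
  have b1 := ContinuousAt.comp' (f := fun z : ℂ × ℂ => z.2) (continuousAt_log_of_im_pos h2) c2
  have b2 := ContinuousAt.comp' (f := fun z : ℂ × ℂ => z.2) (continuousAt_log_one_div_one_sub h2) c2
  have b3 := ContinuousAt.comp' (f := fun z : ℂ × ℂ => z.2) (continuousAt_log_one_sub_one_div h2) c2
  exact ⟨(((continuousAt_const.mul a1).add a2).add b1).add (continuousAt_const.mul b3),
    ((a2.add (continuousAt_const.mul a3)).add b1).add (continuousAt_const.mul b2)⟩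

/-- The two edge equations exponentiate to reciprocal conditions, so one algebraic equation gives
both. -/
theorem exp_edgeSum {z : ℂ × ℂ} (h1 : 0 < z.1.im) (h2 : 0 < z.2.im)
    (h : (z.1 * (1 - z.2)) ^ 2 = (1 - z.1) * z.2) :
    Complex.exp (edgeSum₁ z) = 1 ∧ Complex.exp (edgeSum₂ z) = 1 := by
  obtain ⟨z, w⟩ := z
  simp only at h1 h2 h
  obtain ⟨hz0, hz1⟩ := ne_zero_of_im_pos h1
  obtain ⟨hw0, hw1⟩ := ne_zero_of_im_pos h2
  have hz2 := (ne_zero_of_im_pos (im_one_sub_one_div_pos h1)).1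
  have hw2 := (ne_zero_of_im_pos (im_one_sub_one_div_pos h2)).1
  simp only [edgeSum₁, edgeSum₂, Complex.exp_add, two_mul, Complex.exp_log hz0, Complex.exp_log hw0,
    Complex.exp_log hz2, Complex.exp_log hw2, Complex.exp_log (one_div_ne_zero hz1),
    Complex.exp_log (one_div_ne_zero hw1)]
  constructor
  · field_simp
    linear_combination h
  · field_simp
    linear_combination (z - 1) * h

/-- Logarithms of 1 are spaced 2π apart, so closeness to 2πi pins down the branch. -/
theorem eq_two_pi_I_of_exp_eq_one {p : ℂ} (h : Complex.exp p = 1)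
    (hp : ‖p - 2 * Real.pi * Complex.I‖ < 1) : p = 2 * Real.pi * Complex.I := by
  obtain ⟨n, rfl⟩ := Complex.exp_eq_one_iff.1 h
  have e : (n : ℂ) * (2 * Real.pi * Complex.I) - 2 * Real.pi * Complex.I =
      ((n - 1 : ℤ) : ℂ) * (2 * Real.pi * Complex.I) := by push_cast; ring
  rw [e, norm_mul, Complex.norm_intCast] at hp
  have e2 : ‖(2 * Real.pi * Complex.I : ℂ)‖ = 2 * Real.pi := by
    simp [abs_of_pos Real.pi_pos]
  rw [e2] at hp
  have hn : |((n - 1 : ℤ) : ℝ)| < 1 := by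
    have := Real.pi_gt_three
    nlinarith [abs_nonneg ((n - 1 : ℤ) : ℝ)]
  have hn' : n - 1 = 0 := Int.abs_lt_one_iff.1 (by exact_mod_cast hn)
  have : n = 1 := by omega
  simp [this]

theorem exp_meridianLength (z : DehnFillingSpace) :
    Complex.exp (meridianLength z) = z.1.1 * (1 - z.1.2) := Complex.exp_log (shape_ne_zero z)

/-- Strict bounds persist for nearby u, where the principal logarithm therefore inverts the
exponential. -/
theorem meridianLength_im_mem (z : DehnFillingSpace) :
    (meridianLength z).im ∈ Set.Ioo (-Real.pi) Real.pi := by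
  have h1 := arg_pos_of_im_pos z.2.1
  have h2 : (1 - z.1.2).arg < 0 := Complex.arg_neg_iff.2 (by simpa using z.2.2.1)
  have h3 := Complex.neg_pi_lt_arg (1 - z.1.2)
  have h4 := Complex.arg_le_pi z.1.1
  have h5 : (meridianLength z).im = z.1.1.arg + (1 - z.1.2).arg := by
    rw [meridianLength, Complex.log_im]
    exact Complex.arg_mul (ne_zero_of_im_pos z.2.1).1 (ne_zero_of_im_pos z.2.2.1).2
      ⟨by linarith, by linarith⟩
  rw [h5]
  exact ⟨by linarith, by linarith⟩

/-- The shapes with meridian length `p.1` and ratio `p.2`. -/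
noncomputable def shapesOf (p : ℂ × ℂ) : ℂ × ℂ :=
  (Complex.exp p.1 / (1 - Complex.exp p.1 * p.2), Complex.exp p.1 * p.2)

theorem shapesOf_meridianLength (z : DehnFillingSpace) :
    shapesOf (meridianLength z, shapeRatio z) = z.1 := by
  have h1 := (ne_zero_of_im_pos z.2.2.1).2
  have e : Complex.exp (meridianLength z) * shapeRatio z = z.1.2 := by
    rw [exp_meridianLength, mul_comm, shapeRatio_mul]
  refine Prod.ext ?_ e
  simp only [shapesOf]
  rw [e, exp_meridianLength, mul_div_cancel_right₀ _ h1]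

theorem continuousAt_shapesOf (z : DehnFillingSpace) :
    ContinuousAt shapesOf (meridianLength z, shapeRatio z) := by
  have h1 := (ne_zero_of_im_pos z.2.2.1).2
  have e : Complex.exp (meridianLength z) * shapeRatio z = z.1.2 := by
    rw [exp_meridianLength, mul_comm, shapeRatio_mul]
  have c1 : ContinuousAt (fun p : ℂ × ℂ => Complex.exp p.1) (meridianLength z, shapeRatio z) := by
    fun_prop
  have c2 : ContinuousAt (fun p : ℂ × ℂ => Complex.exp p.1 * p.2)
      (meridianLength z, shapeRatio z) := by fun_prop
  exact (c1.div (continuousAt_const.sub c2) (by simpa [e] using h1)).prodMk c2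

theorem edge_equation_shapesOf {p : ℂ × ℂ} (h0 : p.2 ≠ 0)
    (h1 : 1 - Complex.exp p.1 * p.2 ≠ 0)
    (h : p.2 + p.2⁻¹ = Complex.exp p.1 + (Complex.exp p.1)⁻¹ - 1) :
    ((shapesOf p).1 * (1 - (shapesOf p).2)) ^ 2 = (1 - (shapesOf p).1) * (shapesOf p).2 := by
  have hm := Complex.exp_ne_zero p.1
  simp only [shapesOf]
  generalize Complex.exp p.1 = m at *
  generalize p.2 = W at *
  rw [div_mul_cancel₀ _ h1]
  have e : 1 - m / (1 - m * W) = (1 - m * W - m) / (1 - m * W) := by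
    rw [sub_div _ m, div_self h1]
  rw [e, div_mul_eq_mul_div, eq_div_iff h1]
  field_simp at h
  linear_combination m * h

/-- For u near u₀, a ratio W near W₀ is found by solving W + 1/W = eᵘ + e⁻ᵘ - 1; the pair (u, W)
then gives shapes satisfying the algebraic edge equation, and closeness to the given shapes restores
the logarithmic equations. -/
theorem isOpenMap_meridianLength : IsOpenMap meridianLength := by
  refine isOpenMap_iff_nhds_le.2 fun z => ?_
  set u₀ := meridianLength z
  set W₀ := shapeRatio z with hW₀
  have hW : 0 < W₀.im := shapeRatio_im_pos z
  have hW0 : W₀ ≠ 0 := shapeRatio_ne_zero z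
  have hs : shapesOf (u₀, W₀) = z.1 := shapesOf_meridianLength z
  have hcs : ContinuousAt shapesOf (u₀, W₀) := continuousAt_shapesOf z
  have hts : Tendsto shapesOf (𝓝 (u₀, W₀)) (𝓝 z.1) := hs ▸ hcs.tendsto
  obtain ⟨hE1, hE2⟩ := continuousAt_edgeSum z.2.1 z.2.2.1
  have e1 : edgeSum₁ z.1 = 2 * Real.pi * Complex.I := z.2.2.2.1
  have e2 : edgeSum₂ z.1 = 2 * Real.pi * Complex.I := z.2.2.2.2
  have near : ∀ᶠ q : ℂ × ℂ in 𝓝 z.1, 0 < q.1.im ∧ 0 < q.2.im ∧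
      ‖edgeSum₁ q - 2 * Real.pi * Complex.I‖ < 1 ∧ ‖edgeSum₂ q - 2 * Real.pi * Complex.I‖ < 1 := by
    have n1 : ∀ᶠ q : ℂ × ℂ in 𝓝 z.1, 0 < q.1.im :=
      (Complex.continuous_im.comp continuous_fst).continuousAt.eventually (lt_mem_nhds z.2.1)
    have n2 : ∀ᶠ q : ℂ × ℂ in 𝓝 z.1, 0 < q.2.im :=
      (Complex.continuous_im.comp continuous_snd).continuousAt.eventually (lt_mem_nhds z.2.2.1)
    have n3 := hE1.eventually (Metric.ball_mem_nhds _ one_pos)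
    have n4 := hE2.eventually (Metric.ball_mem_nhds _ one_pos)
    rw [e1] at n3
    rw [e2] at n4
    simp only [dist_eq_norm] at n3 n4
    filter_upwards [n1, n2, n3, n4] with q h1 h2 h3 h4 using ⟨h1, h2, h3, h4⟩
  have hφ : HasStrictDerivAt (fun W : ℂ => W + W⁻¹) (1 + -(W₀ ^ 2)⁻¹) W₀ :=
    (hasStrictDerivAt_id W₀).add (hasStrictDerivAt_inv hW0)
  -- The derivative of W + 1/W vanishes only at ±1, which are excluded by Im W₀ > 0; the inverse
  -- function theorem then makes the map locally onto.
  have hφ' : (1 : ℂ) + -(W₀ ^ 2)⁻¹ ≠ 0 := by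
    intro h
    have h2 : (W₀ ^ 2)⁻¹ = 1 := by linear_combination -h
    have h3 : (W₀ - 1) * (W₀ + 1) = 0 := by linear_combination inv_eq_one.1 h2
    rcases mul_eq_zero.1 h3 with h4 | h4
    · rw [sub_eq_zero.1 h4] at hW; simp at hW
    · rw [eq_neg_of_add_eq_zero_left h4] at hW; simp at hW
  intro S hS
  obtain ⟨T, hT, hTS⟩ := (mem_nhds_subtype _ _ _).1 (mem_map.1 hS)
  have hu : ∀ᶠ p : ℂ × ℂ in 𝓝 (u₀, W₀), p.1.im ∈ Set.Ioo (-Real.pi) Real.pi :=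
    (Complex.continuous_im.comp continuous_fst).continuousAt.eventually
      (isOpen_Ioo.mem_nhds (meridianLength_im_mem z))
  have hp : ∀ᶠ p : ℂ × ℂ in 𝓝 (u₀, W₀), p.2 ≠ 0 :=
    (continuous_snd.tendsto (u₀, W₀)).eventually_ne hW0
  obtain ⟨U, hU, V, hV, hUV⟩ := mem_nhds_prod_iff.1
    (inter_mem (inter_mem (hts.eventually hT) (hts.eventually near)) (inter_mem hu hp))
  have hk : Tendsto (fun u => Complex.exp u + (Complex.exp u)⁻¹ - 1) (𝓝 u₀) (𝓝 (W₀ + W₀⁻¹)) := by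
    rw [hW₀, shapeRatio_add_inv, ← exp_meridianLength]
    have : Continuous fun u => Complex.exp u + (Complex.exp u)⁻¹ - 1 :=
      (Complex.continuous_exp.add (Complex.continuous_exp.inv₀ Complex.exp_ne_zero)).sub
        continuous_const
    exact this.tendsto _
  have hV' : (fun W : ℂ => W + W⁻¹) '' V ∈ 𝓝 (W₀ + W₀⁻¹) := by
    have := image_mem_map (m := fun W : ℂ => W + W⁻¹) hV
    rwa [hφ.map_nhds_eq hφ'] at this
  filter_upwards [hU, hk hV'] with u hu1 hu2
  obtain ⟨W, hWV, hWu⟩ := hu2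
  obtain ⟨⟨q1, q2, q3, q4, q5⟩, q6, q7⟩ := hUV (Set.mk_mem_prod hu1 hWV)
  have h1 : 1 - Complex.exp u * W ≠ 0 := (ne_zero_of_im_pos q3).2
  obtain ⟨x1, x2⟩ := exp_edgeSum q2 q3 (edge_equation_shapesOf q7 h1 hWu)
  have hm : (shapesOf (u, W)).1 * (1 - (shapesOf (u, W)).2) = Complex.exp u := div_mul_cancel₀ _ h1
  have hD : meridianLength ⟨shapesOf (u, W), q2, q3, eq_two_pi_I_of_exp_eq_one x1 q4,
      eq_two_pi_I_of_exp_eq_one x2 q5⟩ = u := by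
    rw [meridianLength, hm, Complex.log_exp q6.1 q6.2.le]
  rw [← hD]
  exact hTS q1

end MeridianCoordinate

end FigureEight

open FigureEight in
theorem mainTheorem5 :
    (∀ z : DehnFillingSpace,
      Module.finrank ℝ (H1F z) = 9 ∧
      Function.Injective (resFiber z) ∧
      (∃ e : H1M z ≃ₗ[ℝ] fixedClasses z, ∀ c : H1M z, (e c : H1F z) = resFiber z c) ∧
      (Module.finrank ℝ (H1M z) = 1 ↔
        ∃! L : Submodule ℝ (H1F z), Module.finrank ℝ L = 1 ∧ ∀ c ∈ L, monodromy z c = c)) ∧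
    IsOpen {z : DehnFillingSpace | Module.finrank ℝ (H1M z) = 1} ∧
    IsOpen {u : ℂ | ∃ z : DehnFillingSpace,
      meridianLength z = u ∧ Module.finrank ℝ (H1M z) = 1} := by
  refine ⟨fun z => ⟨finrank_H1F z, resFiber_injective z, ⟨resFiberEquiv z, fun _ => rfl⟩, ?_⟩,
    isOpen_finrank_H1M_eq_one, ?_⟩
  · rw [(resFiberEquiv z).finrank_eq]
    exact finrank_eq_one_iff_existsUnique (fixedClasses z)
  · convert isOpenMap_meridianLength _ isOpen_finrank_H1M_eq_one using 1
    ext u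
    exact exists_congr fun z => and_comm
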